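/- **Conventions.** A \emph{quasivariety} is a class of algebras of a fixed similarity type axiomatised by a set of quasiequations $s_1\approx t_1\,\&\cdots\&\,s_n\approx t_n\Rightarrow s\approx t$ ($n\ge 0$). Quasivarieties are ordered by inclusion; $Q(\mathcal K)$ is the least quasivariety containing the class $\mathcal K$. The subquasivarieties of a quasivariety form a lattice, with $Q_1\wedge Q_2=Q_1\cap Q_2$ and $Q_1\vee Q_2=Q(Q_1\cup Q_2)$. A \emph{commutative integral residuated lattice} (CIRL) is an algebra $\langle A,\wedge,\vee,*,\Rightarrow,1\rangle$ such that $\langle A,\wedge,\vee\rangle$ is a lattice with maximum $1$, $\langle A,*,1\rangle$ is a commutative monoid, and $a*b\le c\iff b\le a\Rightarrow c$. It is \emph{three-potent} if $a*a\le a*a*a$ for all $a$. Let $\mathcal{RL}_3$ be the quasivariety of all three-potent CIRLs. Nelson's logic $\mathcal S$, in the language $\langle\wedge,\vee,\Rightarrow,\neg,0\rangle$, is given by the following axioms and rules, where $1:=\neg 0$, $\phi\Rightarrow^2\psi:=\phi\Rightarrow(\phi\Rightarrow\psi)$, $\phi\Leftrightarrow\psi:=(\phi\Rightarrow\psi)\wedge(\psi\Rightarrow\phi)$,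 $\Gamma=(\phi_1,\dots,\phi_n)$ is any finite (possibly empty) list of formulas, $\Gamma\Rightarrow\phi:=\phi_1\Rightarrow(\cdots\Rightarrow(\phi_n\Rightarrow\phi))$, and $\Gamma\Rightarrow^2\phi$ is defined similarly with $\Rightarrow^2$. Axioms: $\phi\Rightarrow\phi$; $0\Rightarrow\psi$; $\neg\phi\Rightarrow(\phi\Rightarrow 0)$; $1$; $(\phi\Rightarrow\psi)\Leftrightarrow(\neg\psi\Rightarrow\neg\phi)$. Rules (premises / conclusion): $\Gamma\Rightarrow(\phi\Rightarrow(\psi\Rightarrow\gamma))\,/\,\Gamma\Rightarrow(\psi\Rightarrow(\phi\Rightarrow\gamma))$; $\phi\Rightarrow(\phi\Rightarrow(\phi\Rightarrow\gamma))\,/\,\phi\Rightarrow(\phi\Rightarrow\gamma)$; $\Gamma\Rightarrow\phi,\ \phi\Rightarrow\gamma\,/\,\Gamma\Rightarrow\gamma$; $\Gamma\Rightarrow\phi,\ \psi\Rightarrow\gamma\,/\,\Gamma\Rightarrow((\phi\Rightarrow\psi)\Rightarrow\gamma)$; $\gamma\,/\,\phi\Rightarrow\gamma$; $\phi\Rightarrow\gamma\,/\,(\phi\wedge\psi)\Rightarrow\gamma$;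 $\psi\Rightarrow\gamma\,/\,(\phi\wedge\psi)\Rightarrow\gamma$; $\Gamma\Rightarrow\phi,\ \Gamma\Rightarrow\psi\,/\,\Gamma\Rightarrow(\phi\wedge\psi)$; $\phi\Rightarrow\gamma,\ \psi\Rightarrow\gamma\,/\,(\phi\vee\psi)\Rightarrow\gamma$; $\phi\Rightarrow^2\gamma,\ \psi\Rightarrow^2\gamma\,/\,(\phi\vee\psi)\Rightarrow^2\gamma$; $\Gamma\Rightarrow\phi\,/\,\Gamma\Rightarrow(\phi\vee\psi)$; $\Gamma\Rightarrow\psi\,/\,\Gamma\Rightarrow(\phi\vee\psi)$; $(\phi\wedge\neg\psi)\Rightarrow\gamma\,/\,\neg(\phi\Rightarrow\psi)\Rightarrow\gamma$; $\Gamma\Rightarrow^2(\phi\wedge\neg\psi)\,/\,\Gamma\Rightarrow^2\neg(\phi\Rightarrow\psi)$; $(\neg\phi\vee\neg\psi)\Rightarrow\gamma\,/\,\neg(\phi\wedge\psi)\Rightarrow\gamma$; $\Gamma\Rightarrow(\neg\phi\vee\neg\psi)\,/\,\Gamma\Rightarrow\neg(\phi\wedge\psi)$; $(\neg\phi\wedge\neg\psi)\Rightarrow\gamma\,/\,\neg(\phi\vee\psi)\Rightarrow\gamma$;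 $\Gamma\Rightarrow(\neg\phi\wedge\neg\psi)\,/\,\Gamma\Rightarrow\neg(\phi\vee\psi)$; $\phi\Rightarrow\gamma\,/\,\neg\neg\phi\Rightarrow\gamma$; $\Gamma\Rightarrow\phi\,/\,\Gamma\Rightarrow\neg\neg\phi$. An \emph{$\mathcal S$-algebra} is an algebra $\langle A,\wedge,\vee,\Rightarrow,\neg,0,1\rangle$ that satisfies $\varphi\approx1$ for every axiom $\varphi$, the equation $x\Rightarrow x\approx1$, the quasiequation $\varphi_1\approx1\,\&\cdots\&\,\varphi_n\approx1\Rightarrow\varphi\approx1$ for every rule $\varphi_1,\dots,\varphi_n/\varphi$, and $x\Rightarrow y\approx1\ \&\ y\Rightarrow x\approx1\Rightarrow x\approx y$. Let $\mathcal{BA}$ be the class of Boolean algebras in this language (with $x\Rightarrow y=\neg x\vee y$). For a CIRL $\mathbf A$, the algebra $\mathbf A^*$, in the language of $\mathcal S$-algebras, has as universe the union of $A$ and a disjoint copy $\neg A=\{\neg a:a\in A\}$. The operations of $\mathbf A$ are extended, for $a,b\in A$, by $\neg\neg a=a$; $a\wedge\neg b=\neg b\wedge a=\neg b$; $a\vee\neg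 b=\neg b\vee a=a$; $\neg a\wedge\neg b=\neg(a\vee b)$; $\neg a\vee\neg b=\neg(a\wedge b)$; $a\Rightarrow\neg b=\neg(a*b)$; $\neg a\Rightarrow b=1$; $\neg a\Rightarrow\neg b=b\Rightarrow a$; and $0=\neg1$. For a quasivariety $Q$ of three-potent CIRLs put $Q^*:=Q(\{\mathbf A^*:\mathbf A\in Q\})$. **Proposition.** $(\mathcal{RL}_3)^*$ is a quasivariety of $\mathcal S$-algebras, and the map $Q\mapsto Q^*$ is a lattice embedding (an injective map that preserves binary meets and joins) of the lattice of all subquasivarieties of $\mathcal{RL}_3$ into the interval $\{K:\mathcal{BA}\subseteq K\subseteq(\mathcal{RL}_3)^*\}$ of the lattice of subquasivarieties of $\mathcal S$-algebras. Moreover, this interval has at least $2^{\aleph_0}$ elements. -/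

import Mathlib

open FirstOrder FirstOrder.Language CategoryTheory

universe u

/-! ### Quasiequations and quasivarieties -/

/-- A quasiequation `s₁ ≈ t₁ & … & sₙ ≈ tₙ ⟹ s ≈ t` over an algebraic language, with variables
indexed by `ℕ`; equations are the case `n = 0`. -/
structure QuasiEq (L : FirstOrder.Language.{0, 0}) where
  prems : List (L.Term ℕ × L.Term ℕ)
  concl : L.Term ℕ × L.Term ℕ

/-- The algebra `A` satisfies the quasiequation `q`. -/
def QuasiEq.Holds {L : FirstOrder.Language.{0, 0}} (q : QuasiEq L) (A : Type u) [L.Structure A] : Prop :=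
  ∀ v : ℕ → A, (∀ e ∈ q.prems, e.1.realize v = e.2.realize v) →
    q.concl.1.realize v = q.concl.2.realize v

/-- The class of all algebras that satisfy every quasiequation of `Θ`. -/
def quasiModels {L : FirstOrder.Language.{0, 0}} (Θ : Set (QuasiEq L)) : Set (Bundled.{u} L.Structure) :=
  {A | ∀ q ∈ Θ, q.Holds A}

/-- A quasivariety is a class of algebras axiomatised by a set of quasiequations. -/
def IsQuasivariety {L : FirstOrder.Language.{0, 0}} (K : Set (Bundled.{u} L.Structure)) : Prop :=
  ∃ Θ : Set (QuasiEq L), K = quasiModels Θ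

/-- All quasivarieties of `L`-algebras, ordered by inclusion. -/
def Quasivariety (L : FirstOrder.Language.{0, 0}) : Type (u + 1) :=
  {K : Set (Bundled.{u} L.Structure) // IsQuasivariety K}

namespace Quasivariety

variable {L : FirstOrder.Language.{0, 0}}

instance : PartialOrder (Quasivariety.{u} L) :=
  inferInstanceAs (PartialOrder {K : Set (Bundled.{u} L.Structure) // IsQuasivariety K})

theorem isQuasivariety_sInter (S : Set (Set (Bundled.{u} L.Structure)))
    (hS : ∀ K ∈ S, IsQuasivariety K) : IsQuasivariety (⋂₀ S) := by
  choose! Θ hΘ using hS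
  refine ⟨⋃ K ∈ S, Θ K, ?_⟩
  ext A
  simp only [Set.mem_sInter, quasiModels, Set.mem_iUnion, Set.mem_ofPred_eq]
  constructor
  · rintro h q ⟨K, hK, hq⟩
    have := h K hK
    rw [hΘ K hK] at this
    exact this q hq
  · intro h K hK
    rw [hΘ K hK]
    exact fun q hq => h q ⟨K, hK, hq⟩

instance : InfSet (Quasivariety.{u} L) :=
  ⟨fun S => ⟨⋂₀ (Subtype.val '' S), isQuasivariety_sInter _ (by
    rintro _ ⟨K, _, rfl⟩
    exact K.2)⟩⟩

theorem isGLB_sInf (S : Set (Quasivariety.{u} L)) : IsGLB S (sInf S) := by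
  constructor
  · intro K hK A hA
    exact hA K.1 ⟨K, hK, rfl⟩
  · intro K hK A hA
    rintro _ ⟨K', hK', rfl⟩
    exact hK hK' hA

/-- The complete lattice of quasivarieties: infima are intersections. -/
instance : CompleteLattice (Quasivariety.{u} L) :=
  completeLatticeOfInf _ isGLB_sInf

/-- `Q(K)`, the quasivariety generated by `K`: the least quasivariety that contains `K`. -/
def generate (K : Set (Bundled.{u} L.Structure)) : Quasivariety.{u} L :=
  sInf {Q | K ⊆ Q.1}

end Quasivariety

/-! ### Three-potent commutative integral residuated lattices -/

inductive RLFunc : ℕ → Type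
  | meet : RLFunc 2
  | join : RLFunc 2
  | mul : RLFunc 2
  | imp : RLFunc 2
  | one : RLFunc 0

/-- The language `⟨∧, ∨, *, ⇒, 1⟩` of residuated lattices. -/
def rlLang : FirstOrder.Language.{0, 0} := ⟨RLFunc, fun _ => Empty⟩

namespace RL

variable {A : Type u} [rlLang.Structure A]

def meet (a b : A) : A := Structure.funMap (L := rlLang) RLFunc.meet ![a, b]
def join (a b : A) : A := Structure.funMap (L := rlLang) RLFunc.join ![a, b]
def mul (a b : A) : A := Structure.funMap (L := rlLang) RLFunc.mul ![a, b]
def imp (a b : A) : A := Structure.funMap (L := rlLang) RLFunc.imp ![a, b]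
def one : A := Structure.funMap (L := rlLang) RLFunc.one ![]

end RL

/-- `A` is a commutative integral residuated lattice: `⟨A, ∧, ∨⟩` is a lattice with maximum `1`,
`⟨A, *, 1⟩` is a commutative monoid, and `⇒` is the residual of `*`. -/
def IsCIRL (A : Type u) [rlLang.Structure A] : Prop :=
  ∃ (_ : Lattice A) (_ : CommMonoid A),
    (∀ a b : A, RL.meet a b = a ⊓ b) ∧ (∀ a b : A, RL.join a b = a ⊔ b) ∧
    (∀ a b : A, RL.mul a b = a * b) ∧ (RL.one : A) = 1 ∧
    (∀ a : A, a ≤ 1) ∧ (∀ a b c : A, a * b ≤ c ↔ b ≤ RL.imp a c)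

/-- Three-potency `a² ≤ a³`, where `x ≤ y` means `x ∧ y = x`. -/
def IsThreePotent (A : Type u) [rlLang.Structure A] : Prop :=
  ∀ a : A, RL.meet (RL.mul a a) (RL.mul a (RL.mul a a)) = RL.mul a a

namespace RLTerm

def meet (s t : rlLang.Term ℕ) : rlLang.Term ℕ := Functions.apply₂ (L := rlLang) RLFunc.meet s t
def join (s t : rlLang.Term ℕ) : rlLang.Term ℕ := Functions.apply₂ (L := rlLang) RLFunc.join s t
def mul (s t : rlLang.Term ℕ) : rlLang.Term ℕ := Functions.apply₂ (L := rlLang) RLFunc.mul s t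
def imp (s t : rlLang.Term ℕ) : rlLang.Term ℕ := Functions.apply₂ (L := rlLang) RLFunc.imp s t
def one : rlLang.Term ℕ := Term.func (L := rlLang) RLFunc.one ![]

variable {A : Type u} [rlLang.Structure A] (s t : rlLang.Term ℕ) (v : ℕ → A)

theorem realize_meet : (meet s t).realize v = RL.meet (s.realize v) (t.realize v) :=
  Term.realize_functions_apply₂
theorem realize_join : (join s t).realize v = RL.join (s.realize v) (t.realize v) :=
  Term.realize_functions_apply₂
theorem realize_mul : (mul s t).realize v = RL.mul (s.realize v) (t.realize v) :=
  Term.realize_functions_apply₂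
theorem realize_imp : (imp s t).realize v = RL.imp (s.realize v) (t.realize v) :=
  Term.realize_functions_apply₂
theorem realize_one : (one : rlLang.Term ℕ).realize v = RL.one :=
   congrArg (Structure.funMap (L := rlLang) RLFunc.one) (Subsingleton.elim _ _)

end RLTerm

section

open RLTerm

/-- Quasiequations that axiomatise three-potent commutative integral residuated lattices. -/
def rl3Axioms : List (QuasiEq rlLang) :=
  let x : rlLang.Term ℕ := Term.var 0
  let y : rlLang.Term ℕ := Term.var 1
  let z : rlLang.Term ℕ := Term.var 2
  [⟨[], (join x y, join y x)⟩, ⟨[], (join (join x y) z, join x (join y z))⟩,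
   ⟨[], (meet x y, meet y x)⟩, ⟨[], (meet (meet x y) z, meet x (meet y z))⟩,
   ⟨[], (join x (meet x y), x)⟩, ⟨[], (meet x (join x y), x)⟩,
   ⟨[], (mul x y, mul y x)⟩, ⟨[], (mul (mul x y) z, mul x (mul y z))⟩,
   ⟨[], (mul one x, x)⟩, ⟨[], (meet x one, x)⟩,
   ⟨[(meet (mul x y) z, mul x y)], (meet y (imp x z), y)⟩,
   ⟨[(meet y (imp x z), y)], (meet (mul x y) z, mul x y)⟩,
   ⟨[], (meet (mul x x) (mul x (mul x x)), mul x x)⟩]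

theorem isQuasivariety_rl3 :
    IsQuasivariety {A : Bundled.{u} rlLang.Structure | IsCIRL A ∧ IsThreePotent A} := by
  refine ⟨{q | q ∈ rl3Axioms}, ?_⟩
  ext A
  simp only [quasiModels, rl3Axioms, Set.mem_ofPred_eq, List.forall_mem_cons, List.not_mem_nil,
    false_imp_iff, implies_true, and_true, QuasiEq.Holds, realize_meet, realize_join, realize_mul,
    realize_imp, realize_one, Term.realize_var, true_imp_iff]
  constructor
  · rintro ⟨⟨_, _, h1, h2, h3, h4, h5, h6⟩, h7⟩
    unfold IsThreePotent at h7
    simp only [h1, h2, h3, h4] at h7 ⊢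
    simp only [← inf_eq_left] at h5 h6
    exact ⟨fun _ => sup_comm _ _, fun _ => sup_assoc _ _ _, fun _ => inf_comm _ _,
      fun _ => inf_assoc _ _ _, fun _ => sup_inf_self, fun _ => inf_sup_self,
      fun _ => mul_comm _ _, fun _ => mul_assoc _ _ _, fun _ => one_mul _, fun _ => h5 _,
      fun _ => (h6 _ _ _).1, fun _ => (h6 _ _ _).2, fun _ => h7 _⟩
  · rintro ⟨a1, a2, a3, a4, a5, a6, a7, a8, a9, a10, a11, a12, a13⟩
    let w (a b c : A) : ℕ → A := fun n => if n = 0 then a else if n = 1 then b else c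
    let : Max A := ⟨RL.join⟩
    let : Min A := ⟨RL.meet⟩
    let l : Lattice A := Lattice.mk' (fun a b => a1 (w a b b)) (fun a b c => a2 (w a b c))
      (fun a b => a3 (w a b b)) (fun a b c => a4 (w a b c)) (fun a b => a5 (w a b b))
      (fun a b => a6 (w a b b))
    let m : CommMonoid A :=
      { mul := RL.mul
        one := RL.one
        mul_comm := fun a b => a7 (w a b b)
        mul_assoc := fun a b c => a8 (w a b c)
        one_mul := fun a => a9 (w a a a)
        mul_one := fun a => (a7 (w a RL.one a)).trans (a9 (w a a a)) }
    refine ⟨⟨l, m, fun _ _ => rfl, fun _ _ => rfl, fun _ _ => rfl, rfl, ?_, ?_⟩, ?_⟩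
    · intro a
      exact inf_eq_left.1 (a10 (w a a a))
    · intro a b c
      rw [← inf_eq_left, ← inf_eq_left]
      exact ⟨a11 (w a b c), a12 (w a b c)⟩
    · intro a
      exact a13 (w a a a)

end

/-- The quasivariety (in fact variety) of three-potent commutative integral residuated lattices. -/
def RL3 : Quasivariety.{u} rlLang := ⟨_, isQuasivariety_rl3⟩

/-! ### Algebras for Nelson's logic -/

inductive NFunc : ℕ → Type
  | meet : NFunc 2
  | join : NFunc 2
  | imp : NFunc 2
  | neg : NFunc 1
  | zero : NFunc 0
  | one : NFunc 0

/-- The language `⟨∧, ∨, ⇒, ¬, 0, 1⟩`. -/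
def nLang : FirstOrder.Language.{0, 0} := ⟨NFunc, fun _ => Empty⟩

namespace N

variable {A : Type u} [nLang.Structure A]

def meet (a b : A) : A := Structure.funMap (L := nLang) NFunc.meet ![a, b]
def join (a b : A) : A := Structure.funMap (L := nLang) NFunc.join ![a, b]
def imp (a b : A) : A := Structure.funMap (L := nLang) NFunc.imp ![a, b]
def neg (a : A) : A := Structure.funMap (L := nLang) NFunc.neg ![a]
def zero : A := Structure.funMap (L := nLang) NFunc.zero ![]
def one : A := Structure.funMap (L := nLang) NFunc.one ![]

end N

namespace NTerm

def meet (s t : nLang.Term ℕ) : nLang.Term ℕ := Functions.apply₂ (L := nLang) NFunc.meet s t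
def join (s t : nLang.Term ℕ) : nLang.Term ℕ := Functions.apply₂ (L := nLang) NFunc.join s t
def imp (s t : nLang.Term ℕ) : nLang.Term ℕ := Functions.apply₂ (L := nLang) NFunc.imp s t
def neg (s : nLang.Term ℕ) : nLang.Term ℕ := Functions.apply₁ (L := nLang) NFunc.neg s
def zero : nLang.Term ℕ := Term.func (L := nLang) NFunc.zero ![]
def one : nLang.Term ℕ := Term.func (L := nLang) NFunc.one ![]

/-- `φ ⇒² ψ`, that is, `φ ⇒ (φ ⇒ ψ)`. -/
def imp2 (s t : nLang.Term ℕ) : nLang.Term ℕ := imp s (imp s t)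

/-- `Γ ⇒ φ`, that is, `φ₁ ⇒ (φ₂ ⇒ (… ⇒ (φₙ ⇒ φ)))` for `Γ = (φ₁, …, φₙ)`. -/
def imps (Γ : List (nLang.Term ℕ)) (s : nLang.Term ℕ) : nLang.Term ℕ := Γ.foldr imp s

/-- `Γ ⇒² φ`, that is, `φ₁ ⇒² (φ₂ ⇒² (… ⇒² (φₙ ⇒² φ)))` for `Γ = (φ₁, …, φₙ)`. -/
def imps2 (Γ : List (nLang.Term ℕ)) (s : nLang.Term ℕ) : nLang.Term ℕ := Γ.foldr imp2 s

variable {A : Type u} [nLang.Structure A] (s t : nLang.Term ℕ) (v : ℕ → A)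

theorem realize_meet : (meet s t).realize v = N.meet (s.realize v) (t.realize v) :=
  Term.realize_functions_apply₂
theorem realize_join : (join s t).realize v = N.join (s.realize v) (t.realize v) :=
  Term.realize_functions_apply₂
theorem realize_imp : (imp s t).realize v = N.imp (s.realize v) (t.realize v) :=
  Term.realize_functions_apply₂
theorem realize_neg : (neg s).realize v = N.neg (s.realize v) :=
  Term.realize_functions_apply₁
theorem realize_zero : (zero : nLang.Term ℕ).realize v = N.zero := by
  exact congrArg (Structure.funMap (L := nLang) NFunc.zero) (Subsingleton.elim _ _)
theorem realize_one : (one : nLang.Term ℕ).realize v = N.one := by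
  exact congrArg (Structure.funMap (L := nLang) NFunc.one) (Subsingleton.elim _ _)

end NTerm

section

open NTerm

/-- The axioms of Nelson's logic; in the fourth one, the formula `1` abbreviates `¬0`. -/
inductive NelsonAxiom : nLang.Term ℕ → Prop
  | a1 (φ) : NelsonAxiom (imp φ φ)
  | a2 (ψ) : NelsonAxiom (imp zero ψ)
  | a3 (φ) : NelsonAxiom (imp (neg φ) (imp φ zero))
  | a4 : NelsonAxiom (neg zero)
  | a5 (φ ψ) : NelsonAxiom (meet (imp (imp φ ψ) (imp (neg ψ) (neg φ)))
      (imp (imp (neg ψ) (neg φ)) (imp φ ψ)))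

/-- The rules of Nelson's logic: `NelsonRule [φ₁, …, φₙ] φ` says that `φ` follows from
`φ₁, …, φₙ` by one application of a rule. -/
inductive NelsonRule : List (nLang.Term ℕ) → nLang.Term ℕ → Prop
  | p (Γ φ ψ γ) : NelsonRule [imps Γ (imp φ (imp ψ γ))] (imps Γ (imp ψ (imp φ γ)))
  | c (φ γ) : NelsonRule [imp φ (imp φ (imp φ γ))] (imp φ (imp φ γ))
  | e (Γ φ γ) : NelsonRule [imps Γ φ, imp φ γ] (imps Γ γ)
  | imp_l (Γ φ ψ γ) : NelsonRule [imps Γ φ, imp ψ γ] (imps Γ (imp (imp φ ψ) γ))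
  | imp_r (φ γ) : NelsonRule [γ] (imp φ γ)
  | and_l1 (φ ψ γ) : NelsonRule [imp φ γ] (imp (meet φ ψ) γ)
  | and_l2 (φ ψ γ) : NelsonRule [imp ψ γ] (imp (meet φ ψ) γ)
  | and_r (Γ φ ψ) : NelsonRule [imps Γ φ, imps Γ ψ] (imps Γ (meet φ ψ))
  | or_l1 (φ ψ γ) : NelsonRule [imp φ γ, imp ψ γ] (imp (join φ ψ) γ)
  | or_l2 (φ ψ γ) : NelsonRule [imp2 φ γ, imp2 ψ γ] (imp2 (join φ ψ) γ)
  | or_r1 (Γ φ ψ) : NelsonRule [imps Γ φ] (imps Γ (join φ ψ))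
  | or_r2 (Γ φ ψ) : NelsonRule [imps Γ ψ] (imps Γ (join φ ψ))
  | neg_imp_l (φ ψ γ) : NelsonRule [imp (meet φ (neg ψ)) γ] (imp (neg (imp φ ψ)) γ)
  | neg_imp_r (Γ φ ψ) : NelsonRule [imps2 Γ (meet φ (neg ψ))] (imps2 Γ (neg (imp φ ψ)))
  | neg_and_l (φ ψ γ) : NelsonRule [imp (join (neg φ) (neg ψ)) γ] (imp (neg (meet φ ψ)) γ)
  | neg_and_r (Γ φ ψ) : NelsonRule [imps Γ (join (neg φ) (neg ψ))] (imps Γ (neg (meet φ ψ)))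
  | neg_or_l (φ ψ γ) : NelsonRule [imp (meet (neg φ) (neg ψ)) γ] (imp (neg (join φ ψ)) γ)
  | neg_or_r (Γ φ ψ) : NelsonRule [imps Γ (meet (neg φ) (neg ψ))] (imps Γ (neg (join φ ψ)))
  | neg_neg_l (φ γ) : NelsonRule [imp φ γ] (imp (neg (neg φ)) γ)
  | neg_neg_r (Γ φ) : NelsonRule [imps Γ φ] (imps Γ (neg (neg φ)))

/-- The equations and quasiequations that define `𝒮`-algebras. -/
inductive SAxiom : QuasiEq nLang → Prop
  | ax (φ) (h : NelsonAxiom φ) : SAxiom ⟨[], (φ, one)⟩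
  | refl : SAxiom ⟨[], (imp (Term.var 0) (Term.var 0), one)⟩
  | rule (Φ φ) (h : NelsonRule Φ φ) : SAxiom ⟨Φ.map (fun ψ => (ψ, one)), (φ, one)⟩
  | antisymm : SAxiom ⟨[(imp (Term.var 0) (Term.var 1), one),
      (imp (Term.var 1) (Term.var 0), one)], (Term.var 0, Term.var 1)⟩

end

/-- The quasivariety of `𝒮`-algebras, the equivalent algebraic semantics of Nelson's logic. -/
def SAlg : Quasivariety.{u} nLang := ⟨quasiModels {q | SAxiom q}, _, rfl⟩

/-! ### Boolean algebras -/

/-- `A` is a Boolean algebra in the language `⟨∧, ∨, ⇒, ¬, 0, 1⟩`. -/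
def IsBooleanAlg (A : Type u) [nLang.Structure A] : Prop :=
  ∃ _ : BooleanAlgebra A,
    (∀ a b : A, N.meet a b = a ⊓ b) ∧ (∀ a b : A, N.join a b = a ⊔ b) ∧
    (∀ a b : A, N.imp a b = a ⇨ b) ∧ (∀ a : A, N.neg a = aᶜ) ∧
    (N.zero : A) = ⊥ ∧ (N.one : A) = ⊤

section

open NTerm

/-- Equations that axiomatise Boolean algebras. -/
def baAxioms : List (QuasiEq nLang) :=
  let x : nLang.Term ℕ := Term.var 0
  let y : nLang.Term ℕ := Term.var 1
  let z : nLang.Term ℕ := Term.var 2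
  [⟨[], (join x y, join y x)⟩, ⟨[], (join (join x y) z, join x (join y z))⟩,
   ⟨[], (meet x y, meet y x)⟩, ⟨[], (meet (meet x y) z, meet x (meet y z))⟩,
   ⟨[], (join x (meet x y), x)⟩, ⟨[], (meet x (join x y), x)⟩,
   ⟨[], (meet (join x y) (join x z), join x (meet y z))⟩,
   ⟨[], (meet x one, x)⟩, ⟨[], (meet zero x, zero)⟩,
   ⟨[], (meet x (neg x), zero)⟩, ⟨[], (join x (neg x), one)⟩,
   ⟨[], (imp x y, join y (neg x))⟩]

theorem isQuasivariety_ba :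
    IsQuasivariety {A : Bundled.{u} nLang.Structure | IsBooleanAlg A} := by
  refine ⟨{q | q ∈ baAxioms}, ?_⟩
  ext A
  simp only [quasiModels, baAxioms, Set.mem_ofPred_eq, List.forall_mem_cons, List.not_mem_nil,
    false_imp_iff, implies_true, and_true, QuasiEq.Holds, realize_meet, realize_join, realize_neg,
    realize_imp, realize_one, realize_zero, Term.realize_var, true_imp_iff]
  constructor
  · rintro ⟨_, h1, h2, h3, h4, h5, h6⟩
    simp only [h1, h2, h3, h4, h5, h6]
    exact ⟨fun _ => sup_comm _ _, fun _ => sup_assoc _ _ _, fun _ => inf_comm _ _,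
      fun _ => inf_assoc _ _ _, fun _ => sup_inf_self, fun _ => inf_sup_self,
      fun _ => sup_inf_left _ _ _ |>.symm, fun _ => inf_top_eq _, fun _ => bot_inf_eq _,
      fun _ => inf_compl_eq_bot, fun _ => sup_compl_eq_top, fun _ => himp_eq⟩
  · rintro ⟨a1, a2, a3, a4, a5, a6, a7, a8, a9, a10, a11, a12⟩
    let w (a b c : A) : ℕ → A := fun n => if n = 0 then a else if n = 1 then b else c
    let : Max A := ⟨N.join⟩
    let : Min A := ⟨N.meet⟩
    let l : Lattice A := Lattice.mk' (fun a b => a1 (w a b b)) (fun a b c => a2 (w a b c))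
      (fun a b => a3 (w a b b)) (fun a b c => a4 (w a b c)) (fun a b => a5 (w a b b))
      (fun a b => a6 (w a b b))
    let b : BooleanAlgebra A :=
      { l with
        le_sup_inf := fun a b c => (a7 (w a b c)).le
        compl := N.neg
        top := N.one
        bot := N.zero
        himp := N.imp
        sdiff := fun a b => N.meet a (N.neg b)
        sdiff_eq := fun _ _ => rfl
        himp_eq := fun a b => a12 (w a b b)
        inf_compl_le_bot := fun a => (a10 (w a a a)).le
        top_le_sup_compl := fun a => (a11 (w a a a)).ge
        le_top := fun a => inf_eq_left.1 (a8 (w a a a))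
        bot_le := fun a => inf_eq_left.1 (a9 (w a a a)) }
    exact ⟨b, fun _ _ => rfl, fun _ _ => rfl, fun _ _ => rfl, fun _ => rfl, rfl, rfl⟩

end

/-- The quasivariety (in fact variety) of Boolean algebras. -/
def BA : Quasivariety.{u} nLang := ⟨_, isQuasivariety_ba⟩

/-! ### The Galatos–Raftery doubling construction -/

namespace Doubling

variable {A : Type u} [rlLang.Structure A]

/-! The universe is `A ⊕ A`; `Sum.inl a` is the element `a` and `Sum.inr a` its copy `¬a`. The
lattice operations are those of the order in which `¬a ≤ b` for all `a, b`, the order of `A` is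
kept, and `¬a ≤ ¬b` iff `b ≤ a`. -/

def meet : A ⊕ A → A ⊕ A → A ⊕ A
  | .inl a, .inl b => .inl (RL.meet a b)
  | .inl _, .inr b => .inr b
  | .inr a, .inl _ => .inr a
  | .inr a, .inr b => .inr (RL.join a b)

def join : A ⊕ A → A ⊕ A → A ⊕ A
  | .inl a, .inl b => .inl (RL.join a b)
  | .inl a, .inr _ => .inl a
  | .inr _, .inl b => .inl b
  | .inr a, .inr b => .inr (RL.meet a b)

def imp : A ⊕ A → A ⊕ A → A ⊕ A
  | .inl a, .inl b => .inl (RL.imp a b)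
  | .inl a, .inr b => .inr (RL.mul a b)
  | .inr _, .inl _ => .inl RL.one
  | .inr a, .inr b => .inl (RL.imp b a)

def neg : A ⊕ A → A ⊕ A
  | .inl a => .inr a
  | .inr a => .inl a

end Doubling

/-- The algebra `A*`, with `1` the one of `A` and `0 = ¬1`. The product of `A*` is not in the
language; it is the term operation `x * y = ¬(x ⇒ ¬y)`. -/
instance doubleStructure (A : Type u) [rlLang.Structure A] : nLang.Structure (A ⊕ A) where
  funMap
    | NFunc.meet, x => Doubling.meet (x 0) (x 1)
    | NFunc.join, x => Doubling.join (x 0) (x 1)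
    | NFunc.imp, x => Doubling.imp (x 0) (x 1)
    | NFunc.neg, x => Doubling.neg (x 0)
    | NFunc.zero, _ => .inr RL.one
    | NFunc.one, _ => .inl RL.one
  RelMap := fun r => nomatch r

def doubleAlg (A : Bundled.{u} rlLang.Structure) : Bundled.{u} nLang.Structure :=
  ⟨A ⊕ A, doubleStructure A⟩

/-- `Q* = Q({A* : A ∈ Q})`. -/
def doubleQV (Q : Quasivariety.{u} rlLang) : Quasivariety.{u} nLang :=
  Quasivariety.generate (doubleAlg '' Q.1)

/-! Every element of `A ⊕ A` is a sign together with an element of `A`. Once signs `ε` are fixed for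
the variables, a term of `nLang` becomes a sign, independent of `A`, together with a term of
`rlLang`. Hence a quasiequation `q` holds in the double of `A` iff, for every `ε` under which its
premises match in sign, the two sides of its conclusion match in sign and the residuated
quasiequation `q.unsigned ε` holds in `A` (`Holds.unsigned`, `isLeft_concl`, `holds_double`). The
sign condition is decided by the double of the one-element lattice, which belongs to every
quasivariety. Preservation of joins follows at once.

Conversely, `x ∨ ¬x` recovers the element of `A` without its sign, so each quasiequation of `rlLang`
has a translation that holds in the double exactly when the original holds in `A`
(`positive_holds_double`). This makes `doubleQV` reflect inclusions, hence injective.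

Meets are the main point. If `B` lies in both `Q*` and `R*`, its elements fixed by `x ↦ x ∨ ¬x` form
a residuated lattice `P` in `Q ⊓ R`. A quasiequation valid in the double of `P` has to be carried to
`B`, whose elements need not have signs. For each pattern `ε` on the finitely many relevant
variables, a term `e` is 1 in a double if the pattern occurs and 0 otherwise. Prefixing `e ⇒`
localises to that pattern; the localised conclusion is proved with the unsigned quasiequation in
`P`, and the finitely many localised conclusions together give the original one. Each bridging step
is a quasiequation checked in doubles and transferred to `B`.

The double of the one-element lattice is the two-element Boolean algebra, and prime ideals separate
points of a Boolean algebra by homomorphisms into it; this gives the lower bound `BA`. Doubles of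
three-potent lattices are involutive three-potent residuated lattices, in which the Nelson rules are
order inequalities. For the cardinality, residuated lattices built from cliques of cycles of prime
length, and quasiequations that detect the length, form an independent family; distinct sets of
primes give distinct subquasivarieties of `RL3`, which are then doubled. -/

/-! ### Maps that preserve operations -/

/-- The map `g` commutes with the operations of the language `L`. -/
def PreservesOps (L : FirstOrder.Language.{0, 0}) {A B : Type*} [L.Structure A] [L.Structure B]
    (g : A → B) : Prop :=
  ∀ (n : ℕ) (f : L.Functions n) (x : Fin n → A),
    g (Structure.funMap f x) = Structure.funMap f fun i => g (x i)

theorem PreservesOps.realize {L : FirstOrder.Language.{0, 0}} {A B : Type*} [L.Structure A]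
    [L.Structure B] {g : A → B} (hg : PreservesOps L g) {α : Type*} (t : L.Term α) (v : α → A) :
    g (t.realize v) = t.realize fun i => g (v i) := by
  induction t with
  | var i => rfl
  | func f ts ih =>
    simp only [Term.realize_func]
    rw [hg]
    simp only [ih]

/-- The algebra of terms. -/
instance termStructure (L : FirstOrder.Language.{0, 0}) (α : Type) : L.Structure (L.Term α) where
  funMap f x := Term.func f x
  RelMap _ _ := False

theorem preservesOps_realize {L : FirstOrder.Language.{0, 0}} {A : Type*} [L.Structure A]
    {α : Type} (v : α → A) : PreservesOps L fun t : L.Term α => t.realize v :=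
  fun _ _ _ => rfl

section

variable {L : FirstOrder.Language.{0, 0}} {A : Type*} [L.Structure A]

theorem realize_congr_of_varFinset {t : L.Term ℕ} {v w : ℕ → A}
    (h : ∀ i ∈ t.varFinset, v i = w i) : t.realize v = t.realize w := by
  induction t with
  | var i => exact h i (by simp [Term.varFinset])
  | func f ts ih =>
    simp only [Term.realize_func]
    congr 1
    funext i
    refine ih i fun j hj => h j ?_
    simp only [Term.varFinset, Finset.mem_biUnion]
    exact ⟨i, Finset.mem_univ _, hj⟩

end

/-! ### Membership in quasivarieties, one quasiequation at a time -/

namespace Quasivariety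

variable {L : FirstOrder.Language.{0, 0}}

theorem mem_inf {Q R : Quasivariety.{u} L} {A : Bundled.{u} L.Structure} :
    A ∈ (Q ⊓ R).1 ↔ A ∈ Q.1 ∧ A ∈ R.1 := by
  constructor
  · exact fun h => ⟨(inf_le_left : Q ⊓ R ≤ Q) h, (inf_le_right : Q ⊓ R ≤ R) h⟩
  · intro h
    have hq : IsQuasivariety (⋂₀ {Q.1, R.1}) := isQuasivariety_sInter _ (by
      rintro K (rfl | rfl)
      exacts [Q.2, R.2])
    let J : Quasivariety.{u} L := ⟨_, hq⟩
    have hle : J ≤ Q ⊓ R :=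
      le_inf (fun A hA => hA _ (Or.inl rfl)) (fun A hA => hA _ (Or.inr rfl))
    refine hle ?_
    rintro K (rfl | rfl)
    exacts [h.1, h.2]

theorem generate_le {K : Set (Bundled.{u} L.Structure)} {Q : Quasivariety.{u} L} :
    generate K ≤ Q ↔ K ⊆ Q.1 := by
  constructor
  · refine fun h A hA => h ?_
    rintro _ ⟨R, hR, rfl⟩
    exact hR hA
  · exact fun h => (isGLB_sInf _).1 h

theorem subset_generate (K : Set (Bundled.{u} L.Structure)) : K ⊆ (generate K).1 :=
  generate_le.1 le_rfl

/-- The quasivariety axiomatised by a set of quasiequations. -/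
def ofAxioms (Θ : Set (QuasiEq L)) : Quasivariety.{u} L := ⟨quasiModels Θ, Θ, rfl⟩

theorem eq_ofAxioms (Q : Quasivariety.{u} L) : ∃ Θ : Set (QuasiEq L), Q = ofAxioms Θ := by
  obtain ⟨Θ, h⟩ := Q.2
  exact ⟨Θ, Subtype.ext h⟩

theorem holds_of_mem_generate {K : Set (Bundled.{u} L.Structure)} {q : QuasiEq L}
    (h : ∀ A ∈ K, q.Holds A) {B : Bundled.{u} L.Structure} (hB : B ∈ (generate K).1) :
    q.Holds B := by
  have : generate K ≤ ofAxioms {q} := generate_le.2 fun A hA r hr => by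
    rw [Set.mem_singleton_iff.1 hr]
    exact h A hA
  exact this hB q rfl

theorem mem_of_holds {Q : Quasivariety.{u} L} {B : Bundled.{u} L.Structure}
    (h : ∀ q : QuasiEq L, (∀ A ∈ Q.1, q.Holds A) → q.Holds B) : B ∈ Q.1 := by
  obtain ⟨Θ, rfl⟩ := Q.eq_ofAxioms
  exact fun q hq => h q fun A hA => hA q hq

theorem mem_of_subsingleton (Q : Quasivariety.{u} L) (A : Bundled.{u} L.Structure)
    [Subsingleton A] : A ∈ Q.1 := by
  obtain ⟨Θ, rfl⟩ := Q.eq_ofAxioms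
  exact fun q _ v _ => Subsingleton.elim _ _

end Quasivariety

open Quasivariety

/-! ### Quasiequations in the double -/

section Double

variable {A B : Type*} [rlLang.Structure A] [rlLang.Structure B]

theorem RL.map_meet {g : A → B} (hg : PreservesOps rlLang g) (a b : A) :
    g (RL.meet a b) = RL.meet (g a) (g b) :=
  (hg 2 RLFunc.meet ![a, b]).trans <| congrArg (Structure.funMap (L := rlLang) RLFunc.meet) <| by
    funext i
    fin_cases i <;> rfl

theorem RL.map_join {g : A → B} (hg : PreservesOps rlLang g) (a b : A) :
    g (RL.join a b) = RL.join (g a) (g b) :=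
  (hg 2 RLFunc.join ![a, b]).trans <| congrArg (Structure.funMap (L := rlLang) RLFunc.join) <| by
    funext i
    fin_cases i <;> rfl

theorem RL.map_mul {g : A → B} (hg : PreservesOps rlLang g) (a b : A) :
    g (RL.mul a b) = RL.mul (g a) (g b) :=
  (hg 2 RLFunc.mul ![a, b]).trans <| congrArg (Structure.funMap (L := rlLang) RLFunc.mul) <| by
    funext i
    fin_cases i <;> rfl

theorem RL.map_imp {g : A → B} (hg : PreservesOps rlLang g) (a b : A) :
    g (RL.imp a b) = RL.imp (g a) (g b) :=
  (hg 2 RLFunc.imp ![a, b]).trans <| congrArg (Structure.funMap (L := rlLang) RLFunc.imp) <| by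
    funext i
    fin_cases i <;> rfl

theorem RL.map_one {g : A → B} (hg : PreservesOps rlLang g) : g (RL.one : A) = RL.one :=
  (hg 0 RLFunc.one ![]).trans <| congrArg (Structure.funMap (L := rlLang) RLFunc.one) <|
    Subsingleton.elim _ _

/-- Doubling is functorial. Applied to evaluation homomorphisms out of the term algebra, this
separates signs from values. -/
theorem preservesOps_double {g : A → B} (hg : PreservesOps rlLang g) :
    PreservesOps nLang (Sum.map g g : A ⊕ A → B ⊕ B) := by
  intro n f x
  cases f with
  | meet =>
    change Sum.map g g (Doubling.meet (x 0) (x 1)) =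
      Doubling.meet (Sum.map g g (x 0)) (Sum.map g g (x 1))
    rcases x 0 with a | a <;> rcases x 1 with b | b <;>
      simp [Doubling.meet, RL.map_meet hg, RL.map_join hg]
  | join =>
    change Sum.map g g (Doubling.join (x 0) (x 1)) =
      Doubling.join (Sum.map g g (x 0)) (Sum.map g g (x 1))
    rcases x 0 with a | a <;> rcases x 1 with b | b <;>
      simp [Doubling.join, RL.map_meet hg, RL.map_join hg]
  | imp =>
    change Sum.map g g (Doubling.imp (x 0) (x 1)) = Doubling.imp (Sum.map g g (x 0)) (Sum.map g g (x 1))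
    rcases x 0 with a | a <;> rcases x 1 with b | b <;>
      simp [Doubling.imp, RL.map_imp hg, RL.map_mul hg, RL.map_one hg]
  | neg =>
    change Sum.map g g (Doubling.neg (x 0)) = Doubling.neg (Sum.map g g (x 0))
    rcases x 0 with a | a <;> simp [Doubling.neg]
  | zero => exact congrArg Sum.inr (RL.map_one hg)
  | one => exact congrArg Sum.inl (RL.map_one hg)

end Double

/-- The elements of the double of the term algebra that prescribe the signs `ε` to the variables. -/
def signedVar (ε : ℕ → Bool) (i : ℕ) : rlLang.Term ℕ ⊕ rlLang.Term ℕ :=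
  if ε i then .inl (Term.var i) else .inr (Term.var i)

/-- The value of a term of `nLang` in the double of the term algebra: a sign and a term of
`rlLang`. -/
def signedTerm (ε : ℕ → Bool) (t : nLang.Term ℕ) : rlLang.Term ℕ ⊕ rlLang.Term ℕ :=
  t.realize (signedVar ε)

/-- The underlying element of a signed element. -/
def unsign {X : Type*} : X ⊕ X → X := Sum.elim id id

theorem eq_of_isLeft_eq_of_unsign_eq {X : Type*} {x y : X ⊕ X} (h : x.isLeft = y.isLeft)
    (h' : unsign x = unsign y) : x = y := by
  rcases x with x | x <;> rcases y with y | y <;> simp_all [unsign]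

theorem unsign_map {X Y : Type*} (g : X → Y) (x : X ⊕ X) :
    unsign (Sum.map g g x) = g (unsign x) := by
  rcases x with x | x <;> rfl

theorem map_signedVar {A : Type*} [rlLang.Structure A] {ε : ℕ → Bool} {v : ℕ → A ⊕ A}
    {i : ℕ}     (h : ε i = (v i).isLeft) :
    Sum.map (Term.realize fun i => unsign (v i)) (Term.realize fun i => unsign (v i))
      (signedVar ε i) = v i := by
  unfold signedVar
  rw [h]
  rcases hv : v i with a | a <;> simp [hv, unsign]

theorem realize_signedTerm {A : Type*} [rlLang.Structure A] (ε : ℕ → Bool) (t : nLang.Term ℕ)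
    (v : ℕ → A) :
    Sum.map (Term.realize v) (Term.realize v) (signedTerm ε t) =
      t.realize fun i => Sum.map (Term.realize v) (Term.realize v) (signedVar ε i) :=
  (preservesOps_double (preservesOps_realize v)).realize t _

theorem realize_eq_signedTerm {A : Type*} [rlLang.Structure A] {ε : ℕ → Bool} {t : nLang.Term ℕ}
    {v : ℕ → A ⊕ A} (h : ∀ i ∈ t.varFinset, ε i = (v i).isLeft) :
    t.realize v = Sum.map (Term.realize fun i => unsign (v i))
      (Term.realize fun i => unsign (v i)) (signedTerm ε t) := by
  rw [realize_signedTerm]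
  exact realize_congr_of_varFinset fun i hi => (map_signedVar (h i hi)).symm

namespace QuasiEq

/-- All the premises of `q` equate terms of the same sign. -/
def SignMatch (q : QuasiEq nLang) (ε : ℕ → Bool) : Prop :=
  ∀ e ∈ q.prems, (signedTerm ε e.1).isLeft = (signedTerm ε e.2).isLeft

/-- The quasiequation of `rlLang` that `q` amounts to for elements with signs `ε`. -/
def unsigned (q : QuasiEq nLang) (ε : ℕ → Bool) : QuasiEq rlLang :=
  ⟨q.prems.map fun e => (unsign (signedTerm ε e.1), unsign (signedTerm ε e.2)),
    (unsign (signedTerm ε q.concl.1), unsign (signedTerm ε q.concl.2))⟩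

theorem eq_of_holds_double {q : QuasiEq nLang} {ε : ℕ → Bool} (hε : q.SignMatch ε) {A : Type*}
    [rlLang.Structure A] (h : q.Holds (A ⊕ A)) (v : ℕ → A)
    (hv : ∀ e ∈ q.prems, (unsign (signedTerm ε e.1)).realize v =
      (unsign (signedTerm ε e.2)).realize v) :
    Sum.map (Term.realize v) (Term.realize v) (signedTerm ε q.concl.1) =
      Sum.map (Term.realize v) (Term.realize v) (signedTerm ε q.concl.2) := by
  rw [realize_signedTerm, realize_signedTerm]
  refine h _ fun e he => ?_
  rw [← realize_signedTerm, ← realize_signedTerm]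
  refine eq_of_isLeft_eq_of_unsign_eq ?_ ?_
  · simpa using hε e he
  · rw [unsign_map, unsign_map]
    exact hv e he

theorem Holds.unsigned {q : QuasiEq nLang} {ε : ℕ → Bool} (hε : q.SignMatch ε) {A : Type*}
    [rlLang.Structure A] (h : q.Holds (A ⊕ A)) : (q.unsigned ε).Holds A := by
  intro v hv
  have := congrArg unsign (eq_of_holds_double hε h v fun e he => hv _ (List.mem_map_of_mem he))
  rwa [unsign_map, unsign_map] at this

instance : rlLang.Structure PUnit.{u + 1} where
  funMap _ _ := PUnit.unit
  RelMap _ _ := False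

/-- The one-element residuated lattice. -/
def _root_.trivialRL : Bundled.{u} rlLang.Structure := ⟨PUnit.{u + 1}, inferInstance⟩

/-- Over the one-element lattice all unsigned premises hold trivially, so the double tests nothing
but signs. -/
theorem isLeft_concl {q : QuasiEq nLang} {ε : ℕ → Bool} (hε : q.SignMatch ε)
    (h : q.Holds (PUnit.{u + 1} ⊕ PUnit.{u + 1})) :
    (signedTerm ε q.concl.1).isLeft = (signedTerm ε q.concl.2).isLeft := by
  have := congrArg Sum.isLeft (eq_of_holds_double hε h (fun _ => PUnit.unit) fun _ _ => rfl)
  simpa using this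

/-- A valuation in the double determines its own sign pattern, so it suffices to treat the patterns
separately. -/
theorem holds_double {q : QuasiEq nLang} {A : Type*} [rlLang.Structure A]
    (hc : ∀ ε, q.SignMatch ε → (signedTerm ε q.concl.1).isLeft = (signedTerm ε q.concl.2).isLeft)
    (h : ∀ ε, q.SignMatch ε → (q.unsigned ε).Holds A) : q.Holds (A ⊕ A) := by
  intro v hv
  have key : ∀ t : nLang.Term ℕ, t.realize v = Sum.map (Term.realize fun i => unsign (v i))
      (Term.realize fun i => unsign (v i)) (signedTerm (fun i => (v i).isLeft) t) :=
    fun t => realize_eq_signedTerm fun _ _ => rfl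
  have hm : q.SignMatch fun i => (v i).isLeft := by
    intro e he
    have := congrArg Sum.isLeft (hv e he)
    rw [key, key e.2] at this
    simpa using this
  rw [key, key q.concl.2]
  refine eq_of_isLeft_eq_of_unsign_eq ?_ ?_
  · simpa using hc _ hm
  · rw [unsign_map, unsign_map]
    refine h _ hm _ fun e he => ?_
    obtain ⟨e', he', rfl⟩ := List.mem_map.1 he
    have := congrArg unsign (hv e' he')
    rw [key, key e'.2] at this
    rwa [unsign_map, unsign_map] at this

end QuasiEq

/-! ### Monotonicity and preservation of joins -/

theorem doubleAlg_mem_doubleQV {Q : Quasivariety.{u} rlLang} {A : Bundled.{u} rlLang.Structure}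
    (hA : A ∈ Q.1) : doubleAlg A ∈ (doubleQV Q).1 :=
  subset_generate _ ⟨A, hA, rfl⟩

theorem doubleQV_le {Q : Quasivariety.{u} rlLang} {K : Quasivariety.{u} nLang} :
    doubleQV Q ≤ K ↔ ∀ A ∈ Q.1, doubleAlg A ∈ K.1 :=
  generate_le.trans Set.image_subset_iff

theorem doubleQV_mono {Q R : Quasivariety.{u} rlLang} (h : Q ≤ R) : doubleQV Q ≤ doubleQV R :=
  doubleQV_le.2 fun _ hA => doubleAlg_mem_doubleQV (h hA)

theorem holds_of_mem_doubleQV {Q : Quasivariety.{u} rlLang} {q : QuasiEq nLang}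
    (h : ∀ A ∈ Q.1, q.Holds (A ⊕ A)) {B : Bundled.{u} nLang.Structure}
    (hB : B ∈ (doubleQV Q).1) : q.Holds B := by
  refine holds_of_mem_generate ?_ hB
  rintro _ ⟨A, hA, rfl⟩
  exact h A hA

instance : Subsingleton trivialRL.{u} := inferInstanceAs (Subsingleton PUnit)

theorem doubleQV_sup (Q R : Quasivariety.{u} rlLang) :
    doubleQV (Q ⊔ R) = doubleQV Q ⊔ doubleQV R := by
  refine le_antisymm (doubleQV_le.2 fun A hA => mem_of_holds fun q hq => ?_)
    (sup_le (doubleQV_mono le_sup_left) (doubleQV_mono le_sup_right))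
  have hQ : ∀ C ∈ Q.1, q.Holds (C ⊕ C) := fun C hC =>
    hq _ ((le_sup_left : doubleQV Q ≤ doubleQV Q ⊔ doubleQV R) (doubleAlg_mem_doubleQV hC))
  have hR : ∀ C ∈ R.1, q.Holds (C ⊕ C) := fun C hC =>
    hq _ ((le_sup_right : doubleQV R ≤ doubleQV Q ⊔ doubleQV R) (doubleAlg_mem_doubleQV hC))
  refine QuasiEq.holds_double
    (fun ε hε => QuasiEq.isLeft_concl hε (hQ trivialRL (mem_of_subsingleton _ _))) fun ε hε => ?_
  have : Q ⊔ R ≤ ofAxioms {q.unsigned ε} := sup_le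
    (fun C hC r hr => by rw [Set.mem_singleton_iff.1 hr]; exact (hQ C hC).unsigned hε)
    (fun C hC r hr => by rw [Set.mem_singleton_iff.1 hr]; exact (hR C hC).unsigned hε)
  exact this hA _ rfl

/-! ### Residuated reducts -/

/-- An `nLang`-algebra, viewed as an `rlLang`-algebra with the product `x * y = ¬(x ⇒ ¬y)`. -/
def Reduct (B : Type u) : Type u := B

instance (B : Type u) [nLang.Structure B] : rlLang.Structure (Reduct B) where
  funMap
    | RLFunc.meet, x => (N.meet (x 0) (x 1) : B)
    | RLFunc.join, x => (N.join (x 0) (x 1) : B)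
    | RLFunc.mul, x => (N.neg (N.imp (x 0) (N.neg (x 1))) : B)
    | RLFunc.imp, x => (N.imp (x 0) (x 1) : B)
    | RLFunc.one, _ => (N.one : B)
  RelMap := fun r => nomatch r

namespace N

variable {A B : Type*} [nLang.Structure A] [nLang.Structure B] {g : A → B}

theorem map_meet (hg : PreservesOps nLang g) (a b : A) :
    g (N.meet a b) = N.meet (g a) (g b) :=
  (hg 2 NFunc.meet ![a, b]).trans <| congrArg (Structure.funMap (L := nLang) NFunc.meet) <| by
    funext i
    fin_cases i <;> rfl

theorem map_join (hg : PreservesOps nLang g) (a b : A) :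
    g (N.join a b) = N.join (g a) (g b) :=
  (hg 2 NFunc.join ![a, b]).trans <| congrArg (Structure.funMap (L := nLang) NFunc.join) <| by
    funext i
    fin_cases i <;> rfl

theorem map_imp (hg : PreservesOps nLang g) (a b : A) :
    g (N.imp a b) = N.imp (g a) (g b) :=
  (hg 2 NFunc.imp ![a, b]).trans <| congrArg (Structure.funMap (L := nLang) NFunc.imp) <| by
    funext i
    fin_cases i <;> rfl

theorem map_neg (hg : PreservesOps nLang g) (a : A) : g (N.neg a) = N.neg (g a) :=
  (hg 1 NFunc.neg ![a]).trans <| congrArg (Structure.funMap (L := nLang) NFunc.neg) <| by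
    funext i
    fin_cases i
    rfl

theorem map_one (hg : PreservesOps nLang g) : g (N.one : A) = N.one :=
  (hg 0 NFunc.one ![]).trans <| congrArg (Structure.funMap (L := nLang) NFunc.one) <|
    Subsingleton.elim _ _

/-- The positive element `x ∨ ¬x`. -/
def pos (x : A) : A := N.join x (N.neg x)

theorem map_pos (hg : PreservesOps nLang g) (a : A) : g (pos a) = pos (g a) := by
  rw [pos, map_join hg, map_neg hg, pos]

/-- The square of `x`. -/
def sq (x : A) : A := N.neg (N.imp x (N.neg x))

theorem map_sq (hg : PreservesOps nLang g) (a : A) : g (sq a) = sq (g a) := by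
  rw [sq, map_neg hg, map_imp hg, map_neg hg, sq]

/-- The element that, in a double, is `1` if `x` is positive and `0` if it is negative. -/
def sign (x : A) : A := N.neg (sq (N.neg (sq x)))

theorem map_sign (hg : PreservesOps nLang g) (a : A) : g (sign a) = sign (g a) := by
  rw [sign, map_neg hg, map_sq hg, map_neg hg, map_sq hg, sign]

end N

theorem PreservesOps.reduct {A B : Type*} [nLang.Structure A] [nLang.Structure B] {g : A → B}
    (hg : PreservesOps nLang g) :
    PreservesOps rlLang (A := Reduct A) (B := Reduct B) g := by
  intro n f x
  cases f with
  | meet => exact N.map_meet hg _ _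
  | join => exact N.map_join hg _ _
  | mul =>
    exact (N.map_neg hg _).trans
      (congrArg N.neg ((N.map_imp hg _ _).trans (congrArg _ (N.map_neg hg _))))
  | imp => exact N.map_imp hg _ _
  | one => exact N.map_one (A := A) (B := B) hg

theorem preservesOps_inl (A : Type u) [rlLang.Structure A] :
    PreservesOps rlLang (A := A) (B := Reduct (A ⊕ A)) Sum.inl := by
  intro n f x
  cases f with
  | meet =>
    refine congrArg Sum.inl (congrArg (Structure.funMap (L := rlLang) RLFunc.meet) ?_)
    funext i
    fin_cases i <;> rfl
  | join =>
    refine congrArg Sum.inl (congrArg (Structure.funMap (L := rlLang) RLFunc.join) ?_)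
    funext i
    fin_cases i <;> rfl
  | mul =>
    refine congrArg Sum.inl (congrArg (Structure.funMap (L := rlLang) RLFunc.mul) ?_)
    funext i
    fin_cases i <;> rfl
  | imp =>
    refine congrArg Sum.inl (congrArg (Structure.funMap (L := rlLang) RLFunc.imp) ?_)
    funext i
    fin_cases i <;> rfl
  | one =>
    refine congrArg Sum.inl (congrArg (Structure.funMap (L := rlLang) RLFunc.one) ?_)
    funext i
    exact i.elim0

theorem double_pos {A : Type u} [rlLang.Structure A] (x : A ⊕ A) :
    N.pos x = Sum.inl (unsign x) := by
  rcases x with a | a <;> rfl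

/-- The translation of terms of `rlLang` into `nLang` that substitutes `σ i` for the `i`-th
variable. -/
def substReduct (σ : ℕ → nLang.Term ℕ) (t : rlLang.Term ℕ) : nLang.Term ℕ :=
  Term.realize (M := Reduct (nLang.Term ℕ)) σ t

theorem realize_substReduct {B : Type*} [nLang.Structure B] (σ : ℕ → nLang.Term ℕ)
    (t : rlLang.Term ℕ) (v : ℕ → B) :
    (substReduct σ t).realize v =
      Term.realize (M := Reduct B) (fun i => Term.realize (M := B) v (σ i)) t := by
  have h := PreservesOps.reduct (B := B) (preservesOps_realize (L := nLang) v)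
  exact h.realize t σ

/-! ### The positive part -/

/-- The translation of terms of `rlLang` into `nLang` that replaces a variable `x` by `x ∨ ¬x`. -/
def posSubst (t : rlLang.Term ℕ) : nLang.Term ℕ :=
  substReduct (fun i => N.pos (Term.var i : nLang.Term ℕ)) t

theorem realize_posSubst {B : Type*} [nLang.Structure B] (t : rlLang.Term ℕ) (v : ℕ → B) :
    (posSubst t).realize v = Term.realize (M := Reduct B) (fun i => N.pos (A := B) (v i)) t := by
  refine (realize_substReduct _ t v).trans (congrArg (fun w => Term.realize (M := Reduct B) w t) ?_)
  funext i
  exact N.map_pos (preservesOps_realize v) _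

theorem realize_inl {A : Type u} [rlLang.Structure A] (t : rlLang.Term ℕ) (v : ℕ → A) :
    Term.realize (M := Reduct (A ⊕ A)) (fun i => Sum.inl (v i)) t = Sum.inl (t.realize v) :=
  ((preservesOps_inl A).realize t v).symm

theorem realize_posSubst_double {A : Type u} [rlLang.Structure A] (t : rlLang.Term ℕ)
    (v : ℕ → A ⊕ A) :
    (posSubst t).realize v = Sum.inl (t.realize fun i => unsign (v i)) := by
  rw [realize_posSubst, ← realize_inl]
  congr 1
  funext i
  exact double_pos _

/-- The quasiequation `q` for the positive elements of an `nLang`-algebra. -/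
def QuasiEq.positive (q : QuasiEq rlLang) : QuasiEq nLang :=
  ⟨q.prems.map fun e => (posSubst e.1, posSubst e.2), (posSubst q.concl.1, posSubst q.concl.2)⟩

/-- In a double, `x ∨ ¬x` ranges over exactly the copy of `A`, which is closed under the residuated
operations. -/
theorem QuasiEq.positive_holds_double {q : QuasiEq rlLang} {A : Type u} [rlLang.Structure A] :
    q.positive.Holds (A ⊕ A) ↔ q.Holds A := by
  constructor
  · intro h v hv
    have := h (fun i => Sum.inl (v i)) fun e he => by
      obtain ⟨e', he', rfl⟩ := List.mem_map.1 he
      rw [realize_posSubst_double, realize_posSubst_double]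
      exact congrArg Sum.inl (hv e' he')
    rw [QuasiEq.positive, realize_posSubst_double, realize_posSubst_double] at this
    exact Sum.inl_injective this
  · intro h v hv
    rw [QuasiEq.positive, realize_posSubst_double, realize_posSubst_double]
    refine congrArg Sum.inl (h _ fun e he => ?_)
    have := hv _ (List.mem_map_of_mem he)
    rw [realize_posSubst_double, realize_posSubst_double] at this
    exact Sum.inl_injective this

theorem le_of_doubleQV_le {Q R : Quasivariety.{u} rlLang} (h : doubleQV Q ≤ doubleQV R) :
    Q ≤ R := by
  intro A hA
  refine mem_of_holds fun q hq => QuasiEq.positive_holds_double.1 ?_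
  exact holds_of_mem_doubleQV (fun C hC => QuasiEq.positive_holds_double.2 (hq C hC))
    (h (doubleAlg_mem_doubleQV hA))

theorem doubleQV_injective : Function.Injective doubleQV.{u} :=
  fun _ _ h => le_antisymm (le_of_doubleQV_le h.le) (le_of_doubleQV_le h.ge)

/-- The positive elements of `B`, when they are closed under the operations of residuated
lattices. -/
def positivePart (B : Type u) [nLang.Structure B]
    (h : ∀ (t : rlLang.Term ℕ) (v : ℕ → B),
      N.pos ((posSubst t).realize v) = (posSubst t).realize v) :
    rlLang.Substructure (Reduct B) where
  carrier := {x : B | N.pos x = x}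
  fun_mem {n} f x hx := by
    -- The closure hypothesis is applied to the term `f(x₀, …, xₙ₋₁)`; the values of `v` from `n` on
    -- are irrelevant.
    let v (j : ℕ) : B := if hj : j < n then x ⟨j, hj⟩ else N.one
    have hv : (fun i : Fin n => N.pos (v i)) = x := funext fun i => by
      rw [show v i = x i from dif_pos i.2]
      exact hx i
    have key := h (Term.func f fun i : Fin n => Term.var (i : ℕ)) v
    rw [realize_posSubst] at key
    change N.pos (A := B) (Structure.funMap (M := Reduct B) f fun i : Fin n => N.pos (A := B) (v i))
      = Structure.funMap (M := Reduct B) f fun i : Fin n => N.pos (A := B) (v i) at key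
    rw [hv] at key
    exact key

section

variable {Q : Quasivariety.{u} rlLang} {B : Bundled.{u} nLang.Structure}

/-- This is an equation valid in all doubles, so it passes to every member of the generated
quasivariety. -/
theorem pos_realize_posSubst (hB : B ∈ (doubleQV Q).1) (t : rlLang.Term ℕ) (v : ℕ → B) :
    N.pos ((posSubst t).realize v) = (posSubst t).realize v := by
  have := holds_of_mem_doubleQV (q := ⟨[], (N.pos (posSubst t), posSubst t)⟩)
    (fun A _ w _ => ?_) hB v (by simp)
  · rwa [← N.map_pos (preservesOps_realize v)]
  · dsimp only
    rw [N.map_pos (preservesOps_realize w), double_pos, realize_posSubst_double]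
    rfl

/-- `B` inherits `q.positive` for every `q` valid in `Q`. On elements fixed by `x ↦ x ∨ ¬x` the
substitution does nothing, so `q.positive` says there what `q` says. -/
theorem positivePart_mem (hB : B ∈ (doubleQV Q).1) (h) :
    (⟨positivePart B h, inferInstance⟩ : Bundled.{u} rlLang.Structure) ∈ Q.1 := by
  refine mem_of_holds fun q hq => ?_
  have hq' : q.positive.Holds B :=
    holds_of_mem_doubleQV (fun A hA => QuasiEq.positive_holds_double.2 (hq A hA)) hB
  let c (x : positivePart B h) : B := x.1
  have hc : PreservesOps rlLang (B := Reduct B) c := fun _ _ _ => rfl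
  have key (v : ℕ → positivePart B h) (t : rlLang.Term ℕ) :
      (posSubst t).realize (fun i => c (v i)) = c (t.realize v) := by
    rw [realize_posSubst]
    refine Eq.trans ?_ (hc.realize t v).symm
    congr 1
    funext i
    exact (v i).2
  intro v hv
  have := hq' (fun i => c (v i)) fun e he => by
    obtain ⟨e', he', rfl⟩ := List.mem_map.1 he
    rw [key, key]
    exact congrArg _ (hv e' he')
  rw [QuasiEq.positive, key, key] at this
  exact Subtype.ext this

end

/-! ### Doubles of residuated lattices -/

section

variable {A : Type u} [rlLang.Structure A]

namespace IsCIRL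

theorem one_imp (h : IsCIRL A) (a : A) : RL.imp RL.one a = a := by
  obtain ⟨_, _, -, -, -, h4, -, h6⟩ := h
  rw [h4]
  apply le_antisymm
  · simpa using (h6 1 (RL.imp 1 a) a).2 le_rfl
  · exact (h6 _ _ _).1 (by simp)

theorem imp_one (h : IsCIRL A) (a : A) : RL.imp a RL.one = RL.one := by
  obtain ⟨_, _, -, -, -, h4, h5, h6⟩ := h
  rw [h4]
  exact le_antisymm (h5 _) ((h6 _ _ _).1 (h5 _))

theorem one_mul (h : IsCIRL A) (a : A) : RL.mul RL.one a = a := by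
  obtain ⟨_, _, -, -, h3, h4, -, -⟩ := h
  rw [h3, h4, _root_.one_mul]

theorem meet_self (h : IsCIRL A) (a : A) : RL.meet a a = a := by
  obtain ⟨_, _, h1, -⟩ := h
  rw [h1, inf_idem]

theorem join_self (h : IsCIRL A) (a : A) : RL.join a a = a := by
  obtain ⟨_, _, -, h2, -⟩ := h
  rw [h2, sup_idem]

/-- `{1}` is a subalgebra. It makes localised terms collapse to 1 away from the chosen sign pattern.
-/
theorem realize_one (h : IsCIRL A) (t : rlLang.Term ℕ) :
    t.realize (fun _ => (RL.one : A)) = RL.one := by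
  have key (f : RLFunc 2) (hf : Structure.funMap (L := rlLang) f ![RL.one, RL.one] = (RL.one : A)) :
      (RL.one : A) = Structure.funMap (L := rlLang) f fun _ => (RL.one : A) := by
    refine hf.symm.trans (congrArg (Structure.funMap (L := rlLang) f) ?_)
    funext i
    fin_cases i <;> rfl
  have hg : PreservesOps rlLang fun _ : trivialRL.{0} => (RL.one : A) := by
    intro n f x
    cases f with
    | meet => exact key _ (h.meet_self _)
    | join => exact key _ (h.join_self _)
    | mul => exact key _ (h.one_mul _)
    | imp => exact key _ (h.one_imp _)
    | one => exact congrArg (Structure.funMap (L := rlLang) RLFunc.one) (Subsingleton.elim _ _)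
  exact (hg.realize t fun _ => PUnit.unit).symm

theorem double_one_imp (h : IsCIRL A) (x : A ⊕ A) : N.imp (Sum.inl RL.one) x = x := by
  rcases x with a | a
  · exact congrArg Sum.inl (h.one_imp a)
  · exact congrArg Sum.inr (h.one_mul a)

theorem double_zero_imp (h : IsCIRL A) (x : A ⊕ A) :
    N.imp (Sum.inr RL.one) x = Sum.inl RL.one := by
  rcases x with a | a
  · rfl
  · exact congrArg Sum.inl (h.imp_one a)

/-- The square of a negative element is 0 and that of a positive one is positive. Thus `¬x²` is
negative for positive `x` and 1 for negative `x`; squaring and negating once more gives 1 and 0. -/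
theorem double_sign (h : IsCIRL A) (x : A ⊕ A) :
    N.sign x = if x.isLeft then Sum.inl RL.one else Sum.inr RL.one := by
  rcases x with a | a
  · rfl
  · exact congrArg Sum.inr (h.one_mul _)

end IsCIRL

end

/-! ### Localisation at a sign pattern and preservation of meets -/

/-- The term that, in a double, is `1` if the variables in `l` have the signs `ε`, and `0`
otherwise. -/
def signsTerm (ε : ℕ → Bool) (l : List ℕ) : nLang.Term ℕ :=
  l.foldr (fun i t => N.meet
    (N.sign (if ε i then Term.var i else N.neg (Term.var i : nLang.Term ℕ))) t) NTerm.one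

theorem realize_signsTerm {A : Type u} [rlLang.Structure A] (h : IsCIRL A) (ε : ℕ → Bool)
    (l : List ℕ) (v : ℕ → A ⊕ A) :
    (signsTerm ε l).realize v =
      if ∀ i ∈ l, ε i = (v i).isLeft then Sum.inl RL.one else Sum.inr RL.one := by
  induction l with
  | nil =>
    rw [if_pos (by simp)]
    exact NTerm.realize_one v
  | cons i l ih =>
    have h1 : (signsTerm ε (i :: l)).realize v = N.meet (N.sign (if ε i then v i else N.neg (v i)))
        ((signsTerm ε l).realize v) := by
      rw [signsTerm, List.foldr_cons, N.map_meet (preservesOps_realize v),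
        N.map_sign (preservesOps_realize v)]
      split_ifs
      · rfl
      · rw [N.map_neg (preservesOps_realize v)]
        rfl
    have h2 : N.sign (if ε i then v i else N.neg (v i)) =
        if ε i = (v i).isLeft then Sum.inl RL.one else Sum.inr RL.one := by
      rw [h.double_sign]
      cases ε i <;> rcases v i with a | a <;> rfl
    rw [h1, h2, ih]
    by_cases hi : ε i = (v i).isLeft <;> by_cases hl : ∀ i ∈ l, ε i = (v i).isLeft
    · rw [if_pos hi, if_pos hl, if_pos (by simpa [hi] using hl)]
      exact congrArg Sum.inl (h.meet_self _)
    · rw [if_pos hi, if_neg hl, if_neg (by simpa [hi] using hl)]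
      rfl
    · rw [if_neg hi, if_pos hl, if_neg (by simp [hi])]
      rfl
    · rw [if_neg hi, if_neg hl, if_neg (by simp [hi])]
      exact congrArg Sum.inr (h.join_self _)

/-- The translation of terms of `rlLang` into `nLang` that replaces a variable `x` by
`e ⇒ x ∨ ¬x`, where `e` says that the variables in `l` have the signs `ε`. -/
def localSubst (ε : ℕ → Bool) (l : List ℕ) (t : rlLang.Term ℕ) : nLang.Term ℕ :=
  substReduct (fun i => N.imp (signsTerm ε l) (N.pos (Term.var i : nLang.Term ℕ))) t

theorem realize_localSubst {B : Type*} [nLang.Structure B] (ε : ℕ → Bool) (l : List ℕ)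
    (t : rlLang.Term ℕ) (v : ℕ → B) :
    (localSubst ε l t).realize v =
      Term.realize (M := Reduct B)
        (fun i => N.imp (A := B) ((signsTerm ε l).realize v) (N.pos (v i))) t := by
  refine (realize_substReduct _ t v).trans (congrArg (fun w => Term.realize (M := Reduct B) w t) ?_)
  funext i
  rw [N.map_imp (preservesOps_realize v), N.map_pos (preservesOps_realize v)]
  rfl

theorem realize_localSubst_double {A : Type u} [rlLang.Structure A] (h : IsCIRL A) (ε : ℕ → Bool)
    (l : List ℕ) (t : rlLang.Term ℕ) (v : ℕ → A ⊕ A) :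
    (localSubst ε l t).realize v = if ∀ i ∈ l, ε i = (v i).isLeft then
      Sum.inl (t.realize fun i => unsign (v i)) else Sum.inl RL.one := by
  rw [realize_localSubst, realize_signsTerm h]
  split_ifs
  · rw [← realize_inl]
    congr 1
    funext i
    rw [h.double_one_imp]
    exact double_pos _
  · refine Eq.trans ?_ ((realize_inl t fun _ => RL.one).trans (congrArg Sum.inl (h.realize_one t)))
    congr 1
    funext i
    exact h.double_zero_imp _

theorem realize_signsTerm_imp {A : Type u} [rlLang.Structure A] (h : IsCIRL A) (ε : ℕ → Bool)
    (l : List ℕ) (t : nLang.Term ℕ) (v : ℕ → A ⊕ A) :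
    (N.imp (signsTerm ε l) t).realize v =
      if ∀ i ∈ l, ε i = (v i).isLeft then t.realize v else Sum.inl RL.one := by
  rw [N.map_imp (preservesOps_realize v), realize_signsTerm h]
  split_ifs
  · exact h.double_one_imp _
  · exact h.double_zero_imp _

theorem doubleQV_inf {Q R : Quasivariety.{u} rlLang} (hQ : Q ≤ RL3) :
    doubleQV (Q ⊓ R) = doubleQV Q ⊓ doubleQV R := by
  classical
  refine le_antisymm (le_inf (doubleQV_mono inf_le_left) (doubleQV_mono inf_le_right)) ?_
  intro B hB
  obtain ⟨hBQ, hBR⟩ := mem_inf.1 hB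
  have transfer (q : QuasiEq nLang)
      (h : ∀ A : Bundled.{u} rlLang.Structure, IsCIRL A → q.Holds (A ⊕ A)) : q.Holds B :=
    holds_of_mem_doubleQV (fun A hA => h A (hQ hA).1) hBQ
  have hpos := pos_realize_posSubst hBQ
  have hP : (⟨positivePart B hpos, inferInstance⟩ : Bundled.{u} rlLang.Structure) ∈ (Q ⊓ R).1 :=
    mem_inf.2 ⟨positivePart_mem hBQ hpos, positivePart_mem hBR hpos⟩
  refine mem_of_holds fun q hq => ?_
  obtain ⟨F, hF⟩ : ∃ F : Finset ℕ, ∀ e ∈ q.concl :: q.prems,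
      e.1.varFinset ⊆ F ∧ e.2.varFinset ⊆ F := by
    refine ⟨(q.concl :: q.prems).toFinset.biUnion fun e => e.1.varFinset ∪ e.2.varFinset,
      fun e he => ⟨fun i hi => ?_, fun i hi => ?_⟩⟩ <;>
    exact Finset.mem_biUnion.2 ⟨e, List.mem_toFinset.2 he, by simp [hi]⟩
  intro v hv
  have hsigns {A : Type u} [rlLang.Structure A] {ε : ℕ → Bool} {w : ℕ → A ⊕ A}
      (hm : ∀ i ∈ F.toList, ε i = (w i).isLeft) {e} (he : e ∈ q.concl :: q.prems) :=
    And.intro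
      (realize_eq_signedTerm (t := e.1) fun i hi => hm i (Finset.mem_toList.2 ((hF e he).1 hi)))
      (realize_eq_signedTerm (t := e.2) fun i hi => hm i (Finset.mem_toList.2 ((hF e he).2 hi)))
  -- The conclusion localised at the pattern `ε`.
  have claim (ε : ℕ → Bool) : (N.imp (signsTerm ε F.toList) q.concl.1).realize v =
      (N.imp (signsTerm ε F.toList) q.concl.2).realize v := by
    by_cases hε : q.SignMatch ε
    · have hc := QuasiEq.isLeft_concl hε
        (hq _ (doubleAlg_mem_doubleQV (mem_of_subsingleton _ trivialRL)))
      have hu := QuasiEq.Holds.unsigned hε (hq _ (doubleAlg_mem_doubleQV hP))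
      -- The localised values lie in the positive part, so `q.unsigned ε` can be applied to them
      -- there.
      have hw (i : ℕ) : N.pos (N.imp ((signsTerm ε F.toList).realize v) (N.pos (v i))) =
          N.imp ((signsTerm ε F.toList).realize v) (N.pos (v i)) := by
        have := transfer ⟨[], (N.pos (N.imp (signsTerm ε F.toList) (N.pos (Term.var i))),
          N.imp (signsTerm ε F.toList) (N.pos (Term.var i)))⟩ (fun A _ w _ => ?_) v (by simp)
        · rwa [N.map_pos (preservesOps_realize v), N.map_imp (preservesOps_realize v),
            N.map_pos (preservesOps_realize v)] at this
        · dsimp only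
          rw [N.map_pos (preservesOps_realize w), N.map_imp (preservesOps_realize w),
            N.map_pos (preservesOps_realize w), double_pos, double_pos]
          rcases (signsTerm ε F.toList).realize w with a | a <;> rfl
      let c (x : positivePart B hpos) : B := x.1
      have hc' : PreservesOps rlLang (B := Reduct B) c := fun _ _ _ => rfl
      have hlocal (t : rlLang.Term ℕ) : (localSubst ε F.toList t).realize v =
          c (t.realize fun i => ⟨_, hw i⟩) := by
        rw [realize_localSubst]
        exact (hc'.realize t fun i => ⟨_, hw i⟩).symm
      -- From the localised unsigned conclusion back to the signed one: in a double with pattern `ε`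
      -- the signs agree by `hc`; with another pattern both sides are 1.
      refine transfer ⟨[(localSubst ε F.toList (unsign (signedTerm ε q.concl.1)),
        localSubst ε F.toList (unsign (signedTerm ε q.concl.2)))],
        (N.imp (signsTerm ε F.toList) q.concl.1, N.imp (signsTerm ε F.toList) q.concl.2)⟩
        (fun A hA w hw => ?_) v ?_
      · have := hw _ (List.mem_singleton_self _)
        simp only [realize_localSubst_double hA] at this
        simp only [realize_signsTerm_imp hA]
        split_ifs with hm
        · rw [if_pos hm, if_pos hm] at this
          obtain ⟨h1, h2⟩ := hsigns hm (List.mem_cons_self)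
          rw [h1, h2]
          refine eq_of_isLeft_eq_of_unsign_eq (by simpa using hc) ?_
          rw [unsign_map, unsign_map]
          exact Sum.inl_injective this
        · rfl
      · intro e he
        rw [List.mem_singleton.1 he]
        simp only [hlocal]
        refine congrArg c (hu _ fun e he => ?_)
        obtain ⟨e', he', rfl⟩ := List.mem_map.1 he
        apply Subtype.ext
        refine (hlocal _).symm.trans (Eq.trans ?_ (hlocal _))
        -- Each premise of `q` implies its localised unsigned form, again by comparison in doubles.
        refine transfer ⟨[e'], (localSubst ε F.toList (unsign (signedTerm ε e'.1)),
          localSubst ε F.toList (unsign (signedTerm ε e'.2)))⟩ (fun A hA w hw => ?_) v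
          (by simpa using hv e' he')
        have := hw _ (List.mem_singleton_self _)
        simp only [realize_localSubst_double hA]
        split_ifs with hm
        · obtain ⟨h1, h2⟩ := hsigns hm (List.mem_cons_of_mem _ he')
          rw [h1, h2] at this
          have := congrArg unsign this
          rw [unsign_map, unsign_map] at this
          rw [this]
        · rfl
    · simp only [QuasiEq.SignMatch, not_forall] at hε
      obtain ⟨e, he, hne⟩ := hε
      -- The premise `e` has sides of different sign under `ε`, so in a double where it holds the
      -- pattern is not `ε` and both localised sides are 1.
      refine transfer ⟨[e], (N.imp (signsTerm ε F.toList) q.concl.1,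
        N.imp (signsTerm ε F.toList) q.concl.2)⟩ (fun A hA w hw => ?_) v (by simpa using hv e he)
      simp only [realize_signsTerm_imp hA]
      split_ifs with hm
      · have := hw _ (List.mem_singleton_self _)
        obtain ⟨h1, h2⟩ := hsigns hm (List.mem_cons_of_mem _ he)
        rw [h1, h2] at this
        exact absurd (by simpa using congrArg Sum.isLeft this) hne
      · rfl
  let ε (P : Finset ℕ) (i : ℕ) : Bool := decide (i ∈ P)
  -- Patterns on `F` are coded by subsets. In a double one of these premises belongs to the actual
  -- pattern, and there localisation changes nothing.
  refine transfer ⟨F.powerset.toList.map fun P =>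
    (N.imp (signsTerm (ε P) F.toList) q.concl.1, N.imp (signsTerm (ε P) F.toList) q.concl.2),
    q.concl⟩ (fun A hA w hw => ?_) v fun e he => ?_
  · have := hw _ (List.mem_map_of_mem (Finset.mem_toList.2
      (Finset.mem_powerset.2 (F.filter_subset fun i => (w i).isLeft))))
    simp only [realize_signsTerm_imp hA] at this
    have hm : ∀ i ∈ F.toList, ε (F.filter fun i => (w i).isLeft) i = (w i).isLeft := by
      intro i hi
      simp [ε, Finset.mem_toList.1 hi]
    rwa [if_pos hm, if_pos hm] at this
  · obtain ⟨P, -, rfl⟩ := List.mem_map.1 he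
    exact claim _

/-! ### Boolean algebras -/

/-- A prime ideal containing exactly one of `a` and `b` gives the map: its elements go to 0, the
others to 1. -/
theorem exists_preservesOps_of_ne {B : Type u} [nLang.Structure B] (hB : IsBooleanAlg B) {a b : B}
    (hab : a ≠ b) : ∃ g : B → trivialRL.{u} ⊕ trivialRL.{u}, PreservesOps nLang g ∧ g a ≠ g b := by
  classical
  obtain ⟨_, h1, h2, h3, h4, h5, h6⟩ := hB
  obtain ⟨J, hJ, hne⟩ : ∃ J : Order.Ideal B, J.IsPrime ∧ ¬ (a ∈ J ↔ b ∈ J) := by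
    have key {x y : B} (hxy : ¬ x ≤ y) : ∃ J : Order.Ideal B, J.IsPrime ∧ x ∉ J ∧ y ∈ J := by
      obtain ⟨J, hJ, hI, hF⟩ := DistribLattice.prime_ideal_of_disjoint_filter_ideal
        (F := Order.PFilter.principal x) (I := Order.Ideal.principal y) (by
          rw [Set.disjoint_left]
          exact fun z hz hz' => hxy (le_trans (Order.PFilter.mem_principal.1 hz)
            (Order.Ideal.mem_principal.1 hz')))
      exact ⟨J, hJ, Set.disjoint_left.1 hF (Order.PFilter.mem_principal.2 le_rfl),
        hI (Order.Ideal.mem_principal.2 le_rfl)⟩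
    by_cases h : a ≤ b
    · obtain ⟨J, hJ, hb, ha⟩ := key fun h' => hab (le_antisymm h h')
      exact ⟨J, hJ, by tauto⟩
    · obtain ⟨J, hJ, ha, hb⟩ := key h
      exact ⟨J, hJ, by tauto⟩
  have hinf (x y : B) : x ⊓ y ∈ J ↔ x ∈ J ∨ y ∈ J :=
    ⟨hJ.mem_or_mem, fun h => h.elim (J.lower inf_le_left) (J.lower inf_le_right)⟩
  have hsup (x y : B) : x ⊔ y ∈ J ↔ x ∈ J ∧ y ∈ J := Order.Ideal.sup_mem_iff
  have hcompl (x : B) : xᶜ ∈ J ↔ x ∉ J := by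
    refine ⟨fun h h' => ?_, fun h => hJ.mem_or_compl_mem.resolve_left h⟩
    have htop : (⊤ : B) ∈ J := by
      rw [← sup_compl_eq_top (x := x), hsup]
      exact ⟨h', h⟩
    exact hJ.toIsProper.top_notMem htop
  have htop : (⊤ : B) ∉ J := hJ.toIsProper.top_notMem
  refine ⟨fun x => if x ∈ J then .inr PUnit.unit else .inl PUnit.unit, ?_, ?_⟩
  · intro n f x
    have e2 (y : Fin 2 → B) : y = ![y 0, y 1] := by
      funext i
      fin_cases i <;> rfl
    have e1 (y : Fin 1 → B) : y = ![y 0] := by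
      funext i
      fin_cases i
      rfl
    cases f with
    | meet =>
      have : Structure.funMap (L := nLang) NFunc.meet x = x 0 ⊓ x 1 := by
        rw [← h1, N.meet, ← e2]
      rw [this]
      change _ = Doubling.meet (ite _ _ _) (ite _ _ _)
      by_cases hx : x 0 ∈ J <;> by_cases hy : x 1 ∈ J <;>
        simp only [hinf, hx, hy, or_true, true_or, or_self, if_true, if_false] <;> rfl
    | join =>
      have : Structure.funMap (L := nLang) NFunc.join x = x 0 ⊔ x 1 := by
        rw [← h2, N.join, ← e2]
      rw [this]
      change _ = Doubling.join (ite _ _ _) (ite _ _ _)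
      by_cases hx : x 0 ∈ J <;> by_cases hy : x 1 ∈ J <;>
        simp only [hsup, hx, hy, and_true, true_and, and_self, if_true, if_false] <;> rfl
    | imp =>
      have : Structure.funMap (L := nLang) NFunc.imp x = x 1 ⊔ (x 0)ᶜ := by
        rw [← himp_eq, ← h3, N.imp, ← e2]
      rw [this]
      change _ = Doubling.imp (ite _ _ _) (ite _ _ _)
      by_cases hx : x 0 ∈ J <;> by_cases hy : x 1 ∈ J <;>
        simp only [hsup, hcompl, hx, hy, not_true, not_false_iff, and_true, and_self,
          and_false, if_true, if_false] <;> rfl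
    | neg =>
      have : Structure.funMap (L := nLang) NFunc.neg x = (x 0)ᶜ := by
        rw [← h4, N.neg, ← e1]
      rw [this]
      change _ = Doubling.neg (ite _ _ _)
      by_cases hx : x 0 ∈ J <;>
        simp only [hcompl, hx, not_true, not_false_iff, if_true, if_false] <;> rfl
    | zero =>
      have : Structure.funMap (L := nLang) NFunc.zero x = (⊥ : B) := by
        rw [← h5, N.zero]
        congr 1
        exact Subsingleton.elim _ _
      rw [this]
      exact if_pos J.bot_mem
    | one =>
      have : Structure.funMap (L := nLang) NFunc.one x = (⊤ : B) := by
        rw [← h6, N.one]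
        congr 1
        exact Subsingleton.elim _ _
      rw [this]
      exact if_neg htop
  · intro h
    by_cases ha : a ∈ J <;> by_cases hb : b ∈ J <;> simp_all

theorem BA_le_doubleQV (Q : Quasivariety.{u} rlLang) : BA ≤ doubleQV Q := by
  intro B hB
  refine mem_of_holds fun q hq v hv => ?_
  by_contra hne
  obtain ⟨g, hg, hne'⟩ := exists_preservesOps_of_ne hB hne
  apply hne'
  have h := hq _ (doubleAlg_mem_doubleQV (mem_of_subsingleton Q trivialRL))
  rw [hg.realize, hg.realize]
  refine h _ fun e he => ?_
  exact (hg.realize _ _).symm.trans ((congrArg g (hv e he)).trans (hg.realize _ _))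

/-! ### Soundness of Nelson's logic -/

/-- `B` is a bounded involutive commutative integral residuated lattice that is three-potent, where
the product is `x * y = ¬(x ⇒ ¬y)`. -/
def IsNelsonLattice (B : Type u) [nLang.Structure B] : Prop :=
  ∃ (_ : Lattice B) (_ : CommMonoid B),
    (∀ a b : B, N.meet a b = a ⊓ b) ∧ (∀ a b : B, N.join a b = a ⊔ b) ∧ (N.one : B) = 1 ∧
    (∀ a : B, a ≤ 1) ∧ (∀ a b c : B, a * b ≤ c ↔ b ≤ N.imp a c) ∧ (∀ a : B, N.zero ≤ a) ∧
    N.neg (N.zero : B) = 1 ∧ (∀ a : B, N.neg (N.neg a) = a) ∧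
    (∀ a b : B, N.imp (N.neg a) (N.neg b) = N.imp b a) ∧
    (∀ a b : B, a * b = N.neg (N.imp a (N.neg b))) ∧
    (∀ a b : B, N.neg (a ⊓ b) = N.neg a ⊔ N.neg b) ∧
    (∀ a b : B, N.neg (a ⊔ b) = N.neg a ⊓ N.neg b) ∧ ∀ a : B, a * a ≤ a * (a * a)

/-- The product of a positive and a negative is `a * ¬b = ¬(a ⇒ b)`, and two negatives multiply to
0. Associativity thus reduces to that of `A` and to currying, and residuation to residuation in `A`
or to comparisons forced by sign. -/
theorem isNelsonLattice_double {A : Type u} [rlLang.Structure A] (hA : IsCIRL A)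
    (h3 : IsThreePotent A) : IsNelsonLattice (A ⊕ A) := by
  have one_imp := hA.one_imp
  have imp_one := hA.imp_one
  obtain ⟨_, _, h1, h2, hm, h4, h5, h6⟩ := hA
  unfold IsThreePotent at h3
  simp only [h1, hm, inf_eq_left] at h3
  simp only [h4] at one_imp imp_one
  have le_imp_iff (a b c : A) : b ≤ RL.imp a c ↔ a * b ≤ c := (h6 a b c).symm
  have curry (a b c : A) : RL.imp (a * b) c = RL.imp a (RL.imp b c) := by
    refine eq_of_forall_le_iff fun x => ?_
    rw [le_imp_iff, le_imp_iff, le_imp_iff, mul_assoc, mul_left_comm, mul_left_comm b,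
      mul_left_comm a]
  let : Max (A ⊕ A) := ⟨N.join⟩
  let : Min (A ⊕ A) := ⟨N.meet⟩
  have sup_def (x y : A ⊕ A) : x ⊔ y = Doubling.join x y := rfl
  have inf_def (x y : A ⊕ A) : x ⊓ y = Doubling.meet x y := rfl
  let l : Lattice (A ⊕ A) := Lattice.mk'
    (by rintro (a | a) (b | b) <;> simp [sup_def, Doubling.join, h1, h2, sup_comm, inf_comm])
    (by rintro (a | a) (b | b) (c | c) <;>
          simp [sup_def, Doubling.join, h1, h2, sup_assoc, inf_assoc])
    (by rintro (a | a) (b | b) <;> simp [inf_def, Doubling.meet, h1, h2, sup_comm, inf_comm])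
    (by rintro (a | a) (b | b) (c | c) <;>
          simp [inf_def, Doubling.meet, h1, h2, sup_assoc, inf_assoc])
    (by rintro (a | a) (b | b) <;>
          simp [sup_def, inf_def, Doubling.join, Doubling.meet, h1, h2])
    (by rintro (a | a) (b | b) <;>
          simp [sup_def, inf_def, Doubling.join, Doubling.meet, h1, h2])
  let : Mul (A ⊕ A) := ⟨fun x y => N.neg (N.imp x (N.neg y))⟩
  have ll (a b : A) : (.inl a * .inl b : A ⊕ A) = .inl (a * b) := congrArg Sum.inl (hm a b)
  have lr (a b : A) : (.inl a * .inr b : A ⊕ A) = .inr (RL.imp a b) := rfl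
  have rl (a b : A) : (.inr a * .inl b : A ⊕ A) = .inr (RL.imp b a) := rfl
  have rr (a b : A) : (.inr a * .inr b : A ⊕ A) = .inr 1 := congrArg Sum.inr h4
  have one_mul_double (x : A ⊕ A) : Sum.inl 1 * x = x := by
    rcases x with a | a
    · rw [ll, one_mul]
    · rw [lr, one_imp]
  have mul_comm_double (x y : A ⊕ A) : x * y = y * x := by
    rcases x with a | a <;> rcases y with b | b <;> simp only [ll, lr, rl, rr, mul_comm]
  let m : CommMonoid (A ⊕ A) :=
    { one := Sum.inl 1
      mul_comm := mul_comm_double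
      one_mul := one_mul_double
      mul_one := fun x => (mul_comm_double x _).trans (one_mul_double x)
      mul_assoc := by
        have swap (a b c : A) : RL.imp a (RL.imp b c) = RL.imp b (RL.imp a c) := by
          rw [← curry, ← curry, mul_comm]
        rintro (a | a) (b | b) (c | c) <;>
          simp only [ll, lr, rl, rr, imp_one, curry, mul_assoc]
        all_goals rw [swap] }
  have le_ll (a b : A) : l.toSemilatticeInf.toLE.le (.inl a) (.inl b) ↔ a ≤ b := by
    rw [← inf_eq_left, inf_def, Doubling.meet, h1, Sum.inl.injEq, inf_eq_left]
  have le_lr (a b : A) : ¬ l.toSemilatticeInf.toLE.le (.inl a) (.inr b) := by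
    rw [← inf_eq_left, inf_def, Doubling.meet]
    simp
  have le_rl (a b : A) : l.toSemilatticeInf.toLE.le (.inr a) (.inl b) := by
    rw [← inf_eq_left, inf_def, Doubling.meet]
  have le_rr (a b : A) : l.toSemilatticeInf.toLE.le (.inr a) (.inr b) ↔ b ≤ a := by
    rw [← inf_eq_left, inf_def, Doubling.meet, h2, Sum.inr.injEq, sup_eq_left]
  refine ⟨l, m, fun _ _ => rfl, fun _ _ => rfl, congrArg Sum.inl h4, ?_, ?_, ?_,
    congrArg Sum.inl h4, ?_, ?_, fun _ _ => rfl, ?_, ?_, ?_⟩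
  · rintro (a | a)
    · exact (le_ll _ _).2 (h5 a)
    · exact le_rl _ _
  · rintro (a | a) (b | b) (c | c)
    · rw [ll, le_ll, h6]
      exact (le_ll _ _).symm
    · rw [ll]
      exact iff_of_false (le_lr _ _) (le_lr _ _)
    · rw [lr]
      exact iff_of_true (le_rl _ _) (le_rl _ _)
    · rw [lr, le_rr]
      refine Iff.trans ?_ (le_rr _ _).symm
      rw [le_imp_iff, hm]
    · rw [rl]
      refine iff_of_true (le_rl _ _) ((le_ll _ _).2 ?_)
      rw [h4]
      exact h5 _
    · rw [rl, le_rr]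
      refine Iff.trans ?_ (le_ll _ _).symm
      rw [le_imp_iff, le_imp_iff, mul_comm]
    · rw [rr]
      exact iff_of_true (le_rl _ _) (le_rl _ _)
    · rw [rr, le_rr]
      exact iff_of_true (h5 _) (le_rl _ _)
  · rintro (a | a)
    · exact le_rl _ _
    · refine (le_rr _ _).2 ?_
      rw [h4]
      exact h5 _
  · rintro (a | a) <;> rfl
  · rintro (a | a) (b | b) <;> try rfl
    exact congrArg Sum.inr (by rw [hm, hm, mul_comm])
  · rintro (a | a) (b | b) <;> rfl
  · rintro (a | a) (b | b) <;> rfl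
  · rintro (a | a)
    · rw [ll, ll, le_ll]
      exact h3 a
    · rw [rr]
      refine (le_rr _ _).2 ?_
      exact h5 _

section

open NTerm

/-- An implication has value 1 iff its sides are ordered, and `Γ ⇒ φ` has value 1 iff the product of
`Γ` is below `φ`. Three-potency enters only in the rules `c`, `or_l2` and `neg_imp_r`. -/
theorem mem_SAlg_of_isNelsonLattice {B : Bundled.{u} nLang.Structure} (hB : IsNelsonLattice B) :
    B ∈ SAlg.1 := by
  obtain ⟨_, _, h_meet, h_join, h_one, le_one, resid, zero_le, neg_zero, neg_neg, contra, h_mul,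
    neg_inf, neg_sup, three⟩ := hB
  have mono {a b c d : B} (h : a ≤ b) (h' : c ≤ d) : a * c ≤ b * d := by
    have key {a c d : B} (h : c ≤ d) : a * c ≤ a * d :=
      (resid _ _ _).2 (h.trans ((resid _ _ _).1 le_rfl))
    refine (key h').trans ?_
    rw [mul_comm a, mul_comm b]
    exact key h
  have eq_one {a : B} : a = 1 ↔ 1 ≤ a := ⟨fun h => h.ge, fun h => le_antisymm (le_one a) h⟩
  have imp_eq_one {a b : B} : N.imp a b = 1 ↔ a ≤ b := by
    rw [eq_one, ← resid, mul_one]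
  have mul_le_left (a b : B) : a * b ≤ a := by
    simpa using mono le_rfl (le_one b)
  have neg_imp (a b : B) : N.neg (N.imp a b) = a * N.neg b := by
    rw [h_mul, neg_neg]
  have mul_sup_le {a b c d : B} (h : a * c ≤ d) (h' : b * c ≤ d) : (a ⊔ b) * c ≤ d := by
    rw [mul_comm, resid]
    exact sup_le ((resid _ _ _).1 (by rwa [mul_comm])) ((resid _ _ _).1 (by rwa [mul_comm]))
  have sq_sq (a : B) : a * a * (a * a) = a * a := by
    refine le_antisymm (mul_le_left _ _) ((three a).trans ?_)
    rw [mul_assoc]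
    exact mono le_rfl (three a)
  intro q hq v
  have le_imps (Γ : List (nLang.Term ℕ)) (s : nLang.Term ℕ) (x : B) :
      x ≤ (imps Γ s).realize v ↔ (Γ.map fun t => t.realize v).prod * x ≤ s.realize v := by
    induction Γ generalizing x with
    | nil => simp [imps]
    | cons t Γ ih =>
      have : (imps (t :: Γ) s).realize v = N.imp (t.realize v) ((imps Γ s).realize v) :=
        realize_imp _ _ _
      rw [this, ← resid, ih, List.map_cons, List.prod_cons, mul_left_comm, mul_assoc]
  have le_imps2 (Γ : List (nLang.Term ℕ)) (s : nLang.Term ℕ) (x : B) :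
      x ≤ (imps2 Γ s).realize v ↔
        (Γ.map fun t => t.realize v * t.realize v).prod * x ≤ s.realize v := by
    induction Γ generalizing x with
    | nil => simp [imps2]
    | cons t Γ ih =>
      have : (imps2 (t :: Γ) s).realize v =
          N.imp (t.realize v) (N.imp (t.realize v) ((imps2 Γ s).realize v)) := by
        rw [← realize_imp, ← realize_imp]
        rfl
      rw [this, ← resid, ← resid, ih, List.map_cons, List.prod_cons, ← mul_assoc (t.realize v),
        mul_assoc (t.realize v * t.realize v), mul_left_comm]
  have imps_eq_one (Γ : List (nLang.Term ℕ)) (s : nLang.Term ℕ) :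
      (imps Γ s).realize v = 1 ↔ (Γ.map fun t => t.realize v).prod ≤ s.realize v := by
    rw [eq_one, le_imps, mul_one]
  have imps2_eq_one (Γ : List (nLang.Term ℕ)) (s : nLang.Term ℕ) :
      (imps2 Γ s).realize v = 1 ↔
        (Γ.map fun t => t.realize v * t.realize v).prod ≤ s.realize v := by
    rw [eq_one, le_imps2, mul_one]
  have idem (Γ : List (nLang.Term ℕ)) :
      (Γ.map fun t => t.realize v * t.realize v).prod *
        (Γ.map fun t => t.realize v * t.realize v).prod =
        (Γ.map fun t => t.realize v * t.realize v).prod := by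
    induction Γ with
    | nil => simp
    | cons t Γ ih => rw [List.map_cons, List.prod_cons, mul_mul_mul_comm, ih, sq_sq]
  cases hq with
  | ax φ h =>
    intro _
    dsimp only
    rw [NTerm.realize_one, h_one]
    cases h with
    | a1 φ => rw [realize_imp, imp_eq_one]
    | a2 ψ => rw [realize_imp, imp_eq_one, realize_zero]; exact zero_le _
    | a3 φ =>
      rw [realize_imp, imp_eq_one, realize_imp, ← contra, realize_zero, neg_zero, realize_neg,
        ← resid, one_mul]
    | a4 => rw [realize_neg, realize_zero, neg_zero]
    | a5 φ ψ =>
      simp only [realize_meet, h_meet, realize_imp, realize_neg, contra, inf_idem, imp_eq_one,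
        le_refl]
  | refl =>
    intro _
    dsimp only
    rw [NTerm.realize_one, h_one, realize_imp, imp_eq_one]
  | antisymm =>
    intro h
    simp only [List.forall_mem_cons, realize_imp, NTerm.realize_one, h_one, imp_eq_one,
      Term.realize_var] at h ⊢
    exact le_antisymm h.1 h.2.1
  | rule Φ φ h =>
    intro hp
    simp only [List.forall_mem_map, NTerm.realize_one, h_one] at hp ⊢
    cases h <;>
      simp only [List.forall_mem_cons, imps_eq_one, imps2_eq_one, realize_imp, realize_meet,
        realize_join, realize_neg, imp2, h_meet, h_join, imp_eq_one, neg_inf, neg_sup, neg_neg,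
        neg_imp, List.not_mem_nil, false_imp_iff, implies_true, and_true] at hp ⊢
    case p =>
      simp only [← resid] at hp ⊢
      rwa [mul_left_comm]
    case c =>
      simp only [← resid] at hp ⊢
      exact (three _).trans hp
    case e => exact hp.1.trans hp.2
    case imp_l =>
      rw [← resid]
      refine (mono le_rfl hp.1).trans (le_trans ?_ hp.2)
      rw [mul_comm, resid]
    case imp_r => rw [hp]; exact le_one _
    case and_l1 => exact inf_le_left.trans hp
    case and_l2 => exact inf_le_right.trans hp
    case and_r => exact le_inf hp.1 hp.2
    case or_l1 => exact sup_le hp.1 hp.2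
    case or_l2 =>
      simp only [← resid] at hp ⊢
      have key {a b : B} (x : B) (h : a * a ≤ b) : a * (a * x) ≤ b := by
        rw [← mul_assoc]
        exact (mul_le_left _ _).trans h
      rename_i φ ψ γ
      -- By three-potency the square of the join is below its cube, and a product of three factors
      -- from `φ`, `ψ` contains `φ²` or `ψ²`. This is the mixed case.
      have key' : (φ.realize v ⊔ ψ.realize v) * (φ.realize v * ψ.realize v) ≤ γ.realize v := by
        refine mul_sup_le (key _ hp.1) ?_
        rw [mul_left_comm, mul_comm, mul_assoc]
        exact key _ hp.2
      refine (three _).trans (mul_sup_le ?_ ?_) <;> rw [mul_left_comm] <;>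
        refine mul_sup_le ?_ ?_
      · exact key _ hp.1
      · rwa [← mul_assoc, mul_comm, mul_comm (ψ.realize v)]
      · rwa [← mul_assoc, mul_comm]
      · exact key _ hp.2
    case or_r1 => exact hp.trans le_sup_left
    case or_r2 => exact hp.trans le_sup_right
    case neg_imp_l =>
      exact (le_inf (mul_le_left _ _) (by rw [mul_comm]; exact mul_le_left _ _)).trans hp
    case neg_imp_r Γ φ ψ =>
      -- A product of squares is idempotent, so one copy can be spent on `φ` and one on `¬ψ`.
      rw [← idem]
      exact mono (hp.trans inf_le_left) (hp.trans inf_le_right)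
    case neg_and_l => exact hp
    case neg_and_r => exact hp
    case neg_or_l => exact hp
    case neg_or_r => exact hp
    case neg_neg_l => exact hp
    case neg_neg_r => exact hp

end

theorem doubleQV_RL3_le_SAlg : doubleQV RL3.{u} ≤ SAlg.{u} :=
  doubleQV_le.2 fun _ hA => mem_SAlg_of_isNelsonLattice (isNelsonLattice_double hA.1 hA.2)

/-! ### Residuated lattices with the drastic product -/

section Drastic

variable (L : Type u) [Lattice L] [BoundedOrder L]

open Classical in
/-- The residuated lattice on `L` with a new top element `1` in which `x * y = ⊥` for all
`x, y ≠ 1`. -/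
noncomputable instance drasticStructure : rlLang.Structure (WithTop L) where
  funMap
    | RLFunc.meet, x => x 0 ⊓ x 1
    | RLFunc.join, x => x 0 ⊔ x 1
    | RLFunc.mul, x => if x 0 = ⊤ then x 1 else if x 1 = ⊤ then x 0 else ⊥
    | RLFunc.imp, x => if x 0 ≤ x 1 then ⊤ else if x 0 = ⊤ then x 1 else ((⊤ : L) : WithTop L)
    | RLFunc.one, _ => ⊤
  RelMap := fun r => nomatch r

variable {L}

open Classical in
theorem drastic_mul (a b : WithTop L) :
    RL.mul a b = if a = ⊤ then b else if b = ⊤ then a else ⊥ := rfl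

open Classical in
theorem drastic_imp (a b : WithTop L) :
    RL.imp a b = if a ≤ b then ⊤ else if a = ⊤ then b else ((⊤ : L) : WithTop L) := rfl

theorem drastic_join (a b : WithTop L) : RL.join a b = a ⊔ b := rfl

theorem drastic_one : (RL.one : WithTop L) = ⊤ := rfl

theorem coe_le_coe_top (a : L) : (a : WithTop L) ≤ ((⊤ : L) : WithTop L) :=
  WithTop.coe_le_coe.2 le_top

variable (L) in
-- A triple product with at least two factors other than 1 is `⊥`, whence associativity. If `a ≠ 1`
-- and `a ≰ c`, then `a * b ≤ c` holds exactly for `b ≠ 1`, so the residual is the coatom.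
theorem isCIRL_drastic : IsCIRL (WithTop L) := by
  classical
  have top_mul (a : WithTop L) : RL.mul ⊤ a = a := by simp [drastic_mul]
  have mul_top (a : WithTop L) : RL.mul a ⊤ = a := by
    rw [drastic_mul]
    split_ifs with h
    exacts [h.symm, rfl, absurd rfl ‹_›]
  have coe_mul (a b : L) : RL.mul (a : WithTop L) b = ⊥ := by simp [drastic_mul]
  have bot_mul (a : L) : RL.mul (⊥ : WithTop L) a = ⊥ := coe_mul ⊥ a
  have mul_bot (a : L) : RL.mul (a : WithTop L) ⊥ = ⊥ := coe_mul a ⊥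
  have comm (a b : WithTop L) : RL.mul a b = RL.mul b a := by
    induction a <;> induction b <;> simp only [top_mul, mul_top, coe_mul]
  let m : CommMonoid (WithTop L) :=
    { mul := RL.mul
      one := ⊤
      mul_comm := comm
      one_mul := top_mul
      mul_one := mul_top
      mul_assoc := by
        intro a b c
        change RL.mul (RL.mul a b) c = RL.mul a (RL.mul b c)
        induction a <;> induction b <;> induction c <;>
          simp only [top_mul, mul_top, coe_mul, bot_mul, mul_bot] }
  refine ⟨inferInstance, m, fun _ _ => rfl, fun _ _ => rfl, fun _ _ => rfl, rfl,
    fun a => le_top, fun a b c => ?_⟩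
  change RL.mul a b ≤ c ↔ _
  rw [drastic_imp]
  have mul_le (a b : WithTop L) : RL.mul a b ≤ a := by
    induction a <;> induction b <;> simp [top_mul, mul_top, coe_mul]
  by_cases hac : a ≤ c
  · rw [if_pos hac]
    exact iff_of_true ((mul_le a b).trans hac) le_top
  · rw [if_neg hac]
    split_ifs with ha
    · rw [ha, top_mul]
    · induction a with
      | top => exact absurd rfl ha
      | coe a =>
        induction b with
        | top =>
          rw [mul_top]
          exact iff_of_false hac (by simp)
        | coe b =>
          rw [coe_mul]
          exact iff_of_true bot_le (coe_le_coe_top b)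

variable (L) in
theorem isThreePotent_drastic : IsThreePotent (WithTop L) := by
  classical
  intro a
  have h : RL.mul a a ≤ RL.mul a (RL.mul a a) := by
    induction a with
    | top => simp [drastic_mul]
    | coe a => simp [drastic_mul]
  exact inf_eq_left.2 h

end Drastic

/-! ### Cliques of a cycle -/

/-- The elements of `s` are pairwise equal or consecutive. -/
def PairwiseNear {V : Type*} [CommRing V] (s : Set V) : Prop :=
  ∀ a ∈ s, ∀ b ∈ s, a = b ∨ a = b + 1 ∨ b = a + 1

/-- The lattice of all sets of pairwise equal or consecutive elements, with `V` as top element. -/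
def NearLattice (V : Type u) [CommRing V] : Type u :=
  {s : Set V // PairwiseNear s ∨ s = Set.univ}

section NearLattice

variable {V : Type u} [CommRing V]

theorem PairwiseNear.mono {s t : Set V} (h : s ⊆ t) (ht : PairwiseNear t) : PairwiseNear s :=
  fun a ha b hb => ht a (h ha) b (h hb)

instance : PartialOrder (NearLattice V) :=
  inferInstanceAs (PartialOrder {s : Set V // PairwiseNear s ∨ s = Set.univ})

open Classical in
noncomputable instance : Lattice (NearLattice V) where
  sup s t := ⟨if PairwiseNear (s.1 ∪ t.1) then s.1 ∪ t.1 else Set.univ, by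
    split_ifs with h
    exacts [.inl h, .inr rfl]⟩
  inf s t := ⟨s.1 ∩ t.1, by
    rcases s.2 with h | h
    · exact .inl (h.mono Set.inter_subset_left)
    · rw [h, Set.univ_inter]
      exact t.2⟩
  le_sup_left s t := by
    change s.1 ⊆ ite _ _ _
    split_ifs
    · exact Set.subset_union_left (s := s.1)
    · exact Set.subset_univ s.1
  le_sup_right s t := by
    change t.1 ⊆ ite _ _ _
    split_ifs
    · exact Set.subset_union_right (s := s.1)
    · exact Set.subset_univ t.1
  sup_le s t r hs ht := by
    have hu : s.1 ∪ t.1 ⊆ r.1 := Set.union_subset hs ht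
    change ite _ _ _ ⊆ r.1
    split_ifs with h
    · exact hu
    · rcases r.2 with hr | hr
      · exact absurd (hr.mono hu) h
      · exact hr.ge
  inf_le_left s t := Set.inter_subset_left (s := s.1)
  inf_le_right s t := Set.inter_subset_right (s := s.1)
  le_inf s t r h h' := Set.subset_inter (s := t.1) h h'

instance : BoundedOrder (NearLattice V) where
  top := ⟨Set.univ, .inr rfl⟩
  bot := ⟨∅, .inl fun _ h => h.elim⟩
  le_top s := Set.subset_univ s.1
  bot_le s := Set.empty_subset s.1

theorem sup_eq_top_iff (hV : ¬ PairwiseNear (Set.univ : Set V)) (s t : NearLattice V) :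
    s ⊔ t = ⊤ ↔ ¬ PairwiseNear (s.1 ∪ t.1) := by
  classical
  refine Subtype.ext_iff.trans ?_
  change (if PairwiseNear (s.1 ∪ t.1) then s.1 ∪ t.1 else Set.univ) = Set.univ ↔ _
  split_ifs with h
  · refine iff_of_false (fun h' => hV ?_) (not_not.2 h)
    rwa [h'] at h
  · exact iff_of_true rfl h

/-- The one-element set `{a}`. -/
def NearLattice.single (a : V) : NearLattice V :=
  ⟨{a}, .inl fun _ hb _ hc => .inl (hb.trans hc.symm)⟩

variable {p : ℕ} [CharP V p]

theorem natCast_ne_zero_of_lt {j : ℕ} (hj : 0 < j) (hjp : j < p) : (j : V) ≠ 0 := by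
  rw [Ne, CharP.cast_eq_zero_iff V p]
  exact Nat.not_dvd_of_pos_of_lt hj hjp

theorem not_pairwiseNear_pair (hp : 5 ≤ p) {s : Set V} {a : V} (ha : a ∈ s) (hb : a + 2 ∈ s) :
    ¬ PairwiseNear s := by
  have h1 : ((1 : ℕ) : V) ≠ 0 := natCast_ne_zero_of_lt (p := p) (by omega) (by omega)
  have h2 : ((2 : ℕ) : V) ≠ 0 := natCast_ne_zero_of_lt (p := p) (by omega) (by omega)
  have h3 : ((3 : ℕ) : V) ≠ 0 := natCast_ne_zero_of_lt (p := p) (by omega) (by omega)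
  push_cast at h1 h2 h3
  intro h
  rcases h a ha _ hb with h | h | h
  · exact h2 (by linear_combination -h)
  · exact h3 (by linear_combination -h)
  · exact h1 (by linear_combination h)

/-- A common neighbour of two points that are not near lies strictly between them, so the walk `a,
c, b` keeps its direction. -/
theorem exists_step {a b c : V} (hac : a = c ∨ a = c + 1 ∨ c = a + 1)
    (hcb : c = b ∨ c = b + 1 ∨ b = c + 1) (hab : ¬ (a = b ∨ a = b + 1 ∨ b = a + 1)) :
    ∃ d : V, (d = 1 ∨ d = -1) ∧ c = a + d ∧ b = c + d := by
  rcases hac with rfl | rfl | rfl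
  · exact absurd hcb hab
  · rcases hcb with rfl | rfl | rfl
    · simp at hab
    · exact ⟨-1, .inr rfl, by ring, by ring⟩
    · simp at hab
  · rcases hcb with rfl | h | rfl
    · simp at hab
    · exact absurd (.inl (add_right_cancel h)) hab
    · exact ⟨1, .inl rfl, rfl, rfl⟩

/-- The sets turn out to be single points moving by a constant step `±1`. Returning after `n` steps
forces `n = 0` in `V`. -/
theorem dvd_of_cyclic_near (hp : 5 ≤ p) {n : ℕ} {S : ℕ → Set V} (hS : ∀ i, S (i + n) = S i)
    (h1 : ∀ i, PairwiseNear (S i ∪ S (i + 1))) (h2 : ∀ i, ¬ PairwiseNear (S i ∪ S (i + 2))) :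
    p ∣ n := by
  have far (i : ℕ) : ∃ a ∈ S i, ∃ b ∈ S (i + 2), ¬ (a = b ∨ a = b + 1 ∨ b = a + 1) := by
    by_contra! hcon
    apply h2 i
    rintro a (ha | ha) b (hb | hb)
    · exact h1 i a (.inl ha) b (.inl hb)
    · exact hcon a ha b hb
    · rcases hcon b hb a ha with h | h | h
      exacts [.inl h.symm, .inr (.inr h), .inr (.inl h)]
    · exact h1 (i + 2) a (.inl ha) b (.inl hb)
  have h4 : ((4 : ℕ) : V) ≠ 0 := natCast_ne_zero_of_lt (p := p) (by omega) (by omega)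
  push_cast at h4
  have sub (i : ℕ) : (S (i + 1)).Subsingleton := by
    obtain ⟨a, ha, b, hb, hab⟩ := far i
    intro c hc c' hc'
    have step {c} (hc : c ∈ S (i + 1)) :=
      exists_step (h1 i a (.inl ha) c (.inr hc)) (h1 (i + 1) c (.inl hc) b (.inr hb)) hab
    obtain ⟨d, hd, h, h'⟩ := step hc
    obtain ⟨e, he, k, k'⟩ := step hc'
    rcases hd with rfl | rfl <;> rcases he with rfl | rfl
    · rw [h, k]
    -- Opposite directions would give `a + 2 = b = a - 2`, hence `4 = 0`.
    · exact absurd (by linear_combination k' - h' - h + k) h4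
    · exact absurd (by linear_combination h' - k' - k + h) h4
    · rw [h, k]
  choose y hy hfar using far
  choose z hz hfar using hfar
  have hzy (i : ℕ) : z (i + 1) = y (i + 3) := sub (i + 2) (hz (i + 1)) (hy (i + 3))
  have step (i : ℕ) : ∃ d : V, (d = 1 ∨ d = -1) ∧ y (i + 2) = y (i + 1) + d ∧
      y (i + 3) = y (i + 2) + d := by
    have := hfar (i + 1)
    rw [hzy] at this
    exact exists_step (h1 (i + 1) _ (.inl (hy _)) _ (.inr (hy _)))
      (h1 (i + 2) _ (.inl (hy _)) _ (.inr (hy _))) this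
  obtain ⟨d, hd, hd', -⟩ := step 0
  have lin (i : ℕ) : y (i + 1) = y 1 + i * d ∧ y (i + 2) = y (i + 1) + d := by
    induction i with
    | zero => exact ⟨by simp, hd'⟩
    | succ i ih =>
      refine ⟨?_, ?_⟩
      · rw [ih.2, ih.1]
        push_cast
        ring
      · obtain ⟨e, -, he, he'⟩ := step i
        have : e = d := add_left_cancel (he.symm.trans ih.2)
        rw [he', this]
  have hn : y (n + 1) = y 1 := by
    refine sub 0 ?_ (hy 1)
    rw [zero_add, ← hS 1, add_comm 1]
    exact hy (n + 1)
  have hnd : (n : V) * d = 0 := by linear_combination hn - (lin n).1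
  rw [← CharP.cast_eq_zero_iff V p]
  rcases hd with rfl | rfl
  · simpa using hnd
  · simpa using hnd

end NearLattice

/-! ### Independent quasiequations -/

section

open RLTerm

/-- In residuated lattices with the drastic product, this quasiequation excludes cycles of `n`
elements in which the join of two elements is the coatom if they have distance two in the cycle,
and smaller if they are neighbours. -/
def cycleQuasiEq (n : ℕ) : QuasiEq rlLang where
  prems := (List.range n).flatMap fun i =>
    [(imp (Term.var n) (join (Term.var (i % n)) (Term.var ((i + 1) % n))), Term.var n),
      (join (Term.var (i % n)) (Term.var ((i + 2) % n)), Term.var n)]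
  concl := (Term.var n, one)

theorem cycleQuasiEq_holds_iff {n : ℕ} (hn : 0 < n) (A : Type u) [rlLang.Structure A] :
    (cycleQuasiEq n).Holds A ↔ ∀ v : ℕ → A,
      (∀ i, RL.imp (v n) (RL.join (v (i % n)) (v ((i + 1) % n))) = v n ∧
        RL.join (v (i % n)) (v ((i + 2) % n)) = v n) → v n = RL.one := by
  refine forall_congr' fun v => ?_
  have hprem : (∀ e ∈ (cycleQuasiEq n).prems, e.1.realize v = e.2.realize v) ↔
      ∀ i, RL.imp (v n) (RL.join (v (i % n)) (v ((i + 1) % n))) = v n ∧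
        RL.join (v (i % n)) (v ((i + 2) % n)) = v n := by
    simp only [cycleQuasiEq, List.forall_mem_flatMap, List.forall_mem_cons, List.not_mem_nil,
      false_imp_iff, implies_true, and_true, realize_imp, realize_join, Term.realize_var,
      List.mem_range]
    refine ⟨fun h i => ?_, fun h i _ => h i⟩
    simpa only [Nat.mod_mod, Nat.mod_add_mod] using h (i % n) (Nat.mod_lt _ hn)
  rw [hprem]
  simp only [cycleQuasiEq, Term.realize_var, RLTerm.realize_one]

end

section

variable {V : Type u} [CommRing V] {p : ℕ} [CharP V p]

/-- A counterexample would be a cyclic family of `n` cliques with near unions for neighbours and far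
unions at distance two, so `p ∣ n` by `dvd_of_cyclic_near`. -/
theorem cycleQuasiEq_holds (hp : 5 ≤ p) {n : ℕ} (hn : 0 < n) (hpn : ¬ p ∣ n) :
    (cycleQuasiEq n).Holds (WithTop (NearLattice V)) := by
  classical
  rw [cycleQuasiEq_holds_iff hn]
  intro v hv
  by_contra hm
  rw [drastic_one] at hm
  -- With `v n ≠ 1`, the residual `v n ⇒ x` is 1 or the coatom; being equal to `v n`, it is the
  -- coatom.
  have key {x : WithTop (NearLattice V)} (h : RL.imp (v n) x = v n) :
      v n = ((⊤ : NearLattice V) : WithTop (NearLattice V)) ∧ ¬ v n ≤ x := by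
    rw [drastic_imp] at h
    split_ifs at h with h1
    · exact absurd h.symm hm
    · exact ⟨h.symm, h1⟩
  have hmtop := (key (hv 0).1).1
  have hX (i : ℕ) : ∃ s : NearLattice V, v (i % n) = s := by
    have h := (key (hv i).1).2
    rw [drastic_join] at h
    cases hx : v (i % n) with
    | top =>
      rw [hx, top_sup_eq] at h
      exact absurd le_top h
    | coe s => exact ⟨s, rfl⟩
  choose S hS using hX
  have hV : ¬ PairwiseNear (Set.univ : Set V) :=
    not_pairwiseNear_pair (p := p) hp (Set.mem_univ 0) (Set.mem_univ _)
  refine hpn (dvd_of_cyclic_near (S := fun i => (S i).1) hp (fun i => ?_) (fun i => ?_) fun i => ?_)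
  · have : (S (i + n) : WithTop (NearLattice V)) = S i := by
      rw [← hS, ← hS, Nat.add_mod_right]
    rw [WithTop.coe_injective this]
  · by_contra h
    refine (key (hv i).1).2 ?_
    rw [drastic_join, hS, hS, ← WithTop.coe_sup, (sup_eq_top_iff hV _ _).2 h, hmtop]
  · have h := (hv i).2
    rw [drastic_join, hS, hS, ← WithTop.coe_sup, hmtop] at h
    exact (sup_eq_top_iff hV _ _).1 (WithTop.coe_injective h)

variable (V) in
theorem cycleQuasiEq_not_holds (hp : 5 ≤ p) :
    ¬ (cycleQuasiEq p).Holds (WithTop (NearLattice V)) := by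
  classical
  rw [cycleQuasiEq_holds_iff (by omega)]
  intro h
  -- The counterexample is the cycle itself, as singletons, with the coatom as the value of the
  -- variable `p`.
  let v (i : ℕ) : WithTop (NearLattice V) :=
    if i < p then NearLattice.single (i : V) else (⊤ : NearLattice V)
  have hvp : v p = (⊤ : NearLattice V) := if_neg (lt_irrefl p)
  have hv (i : ℕ) : v (i % p) = NearLattice.single (i : V) := by
    rw [show v (i % p) = NearLattice.single ((i % p : ℕ) : V) from
      if_pos (Nat.mod_lt _ (by omega)), ← CharP.cast_eq_mod V p]
  have hV : ¬ PairwiseNear (Set.univ : Set V) :=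
    not_pairwiseNear_pair (p := p) hp (Set.mem_univ 0) (Set.mem_univ _)
  have := h v fun i => ?_
  · rw [hvp] at this
    exact WithTop.coe_ne_top this
  · rw [hvp, hv, hv, hv, drastic_join, drastic_join, ← WithTop.coe_sup, ← WithTop.coe_sup]
    refine ⟨?_, congrArg _ ((sup_eq_top_iff hV _ _).2
      (not_pairwiseNear_pair (p := p) hp (a := (i : V)) (.inl rfl) (.inr ?_)))⟩
    · rw [drastic_imp, if_neg, if_neg WithTop.coe_ne_top]
      rw [WithTop.coe_le_coe, top_le_iff, sup_eq_top_iff hV, not_not]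
      rintro a (rfl | rfl) b (rfl | rfl) <;> simp
    · change (i : V) + 2 = ((i + 2 : ℕ) : V)
      push_cast
      rfl

end

/-- The residuated lattice of the cliques of a cycle of length `p`. -/
noncomputable def cycleRL (p : ℕ) : Bundled.{u} rlLang.Structure :=
  ⟨WithTop (NearLattice (ULift.{u} (ZMod p))), inferInstance⟩

theorem cycleRL_mem_RL3 (p : ℕ) : cycleRL.{u} p ∈ RL3.{u}.1 :=
  ⟨isCIRL_drastic _, isThreePotent_drastic _⟩

theorem cycleQuasiEq_holds_cycleRL {p q : ℕ} (hp : p.Prime) (hp5 : 5 ≤ p) (hq : q.Prime)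
    (hq5 : 5 ≤ q) : (cycleQuasiEq q).Holds (cycleRL.{u} p) ↔ p ≠ q := by
  constructor
  · rintro h rfl
    exact cycleQuasiEq_not_holds (p := p) (ULift.{u} (ZMod p)) hp5 h
  · intro h
    exact cycleQuasiEq_holds hp5 hq.pos fun h' => h ((Nat.prime_dvd_prime_iff_eq hp hq).1 h')

/-! ### Counting subquasivarieties -/

theorem continuum_le_mk_Iic_RL3 : Cardinal.continuum ≤ Cardinal.mk (Set.Iic RL3.{u}) := by
  let P : Set ℕ := {p | p.Prime ∧ 5 ≤ p}
  have hP : P.Infinite := Set.infinite_of_not_bddAbove fun ⟨N, hN⟩ => by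
    obtain ⟨p, hp, hprime⟩ := Nat.exists_infinite_primes (N + 5)
    have := hN ⟨hprime, by omega⟩
    omega
  have : Infinite P := hP.to_subtype
  -- Imposing the quasiequations of the primes outside `S` excludes exactly the cycle lattices of
  -- those primes, so `S` can be read off. `ULift` only matches universes.
  let F (S : ULift.{u + 1} (Set P)) : Set.Iic RL3.{u} :=
    ⟨RL3 ⊓ ofAxioms ((fun p : P => cycleQuasiEq p) '' S.downᶜ), Set.mem_Iic.2 inf_le_left⟩
  have hF (S : ULift.{u + 1} (Set P)) (p : P) : cycleRL.{u} p ∈ (F S).1.1 ↔ p ∈ S.down := by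
    rw [mem_inf]
    constructor
    · rintro ⟨-, h⟩
      by_contra hpS
      exact (cycleQuasiEq_holds_cycleRL p.2.1 p.2.2 p.2.1 p.2.2).1 (h _ ⟨p, hpS, rfl⟩) rfl
    · refine fun hpS => ⟨cycleRL_mem_RL3 _, ?_⟩
      rintro _ ⟨q, hq, rfl⟩
      refine (cycleQuasiEq_holds_cycleRL p.2.1 p.2.2 q.2.1 q.2.2).2 fun h => hq ?_
      rwa [← Subtype.ext h]
  have hinj : Function.Injective F := by
    intro S T h
    refine ULift.ext _ _ (Set.ext fun p => ?_)
    rw [← hF S, ← hF T, h]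
  have := Cardinal.mk_le_of_injective hinj
  simpa using this

theorem mainTheorem12 :
    doubleQV RL3.{u} ≤ SAlg.{u} ∧
    (∃ f : LatticeHom (Set.Iic RL3.{u}) (Set.Icc BA.{u} (doubleQV RL3.{u})),
      (∀ Q : Set.Iic RL3.{u},
        (f Q : Quasivariety.{u} nLang) = doubleQV (Q : Quasivariety.{u} rlLang)) ∧
      Function.Injective f) ∧
    Cardinal.continuum ≤ Cardinal.mk (Set.Icc BA.{u} (doubleQV RL3.{u})) := by
  let f : LatticeHom (Set.Iic RL3.{u}) (Set.Icc BA.{u} (doubleQV RL3.{u})) :=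
    { toFun := fun Q => ⟨doubleQV Q.1, BA_le_doubleQV _, doubleQV_mono Q.2⟩
      map_sup' := fun Q R => Subtype.ext (doubleQV_sup Q.1 R.1)
      map_inf' := fun Q R => Subtype.ext (doubleQV_inf Q.2) }
  have hf : Function.Injective f := fun Q R h =>
    Subtype.ext (doubleQV_injective (congrArg Subtype.val h))
  exact ⟨doubleQV_RL3_le_SAlg, ⟨f, fun _ => rfl, hf⟩,
    continuum_le_mk_Iic_RL3.trans (Cardinal.mk_le_of_injective hf)⟩
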